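/- Let $T\ge 0$, let $U,V$ be non-empty compact metric spaces, and for $i=1,2$ let $$L^i_t[u,v]\varphi(x)=\tfrac12\sum_{j,k}G^i_{jk}(t,x,u,v)\,\partial_j\partial_k\varphi(x)+\langle f^i(t,x,u,v),\nabla\varphi(x)\rangle+\int_{\mathbb R^d}\bigl[\varphi(x+y)-\varphi(x)-\langle y,\nabla\varphi(x)\rangle\mathbf 1_{B_1}(y)\bigr]\nu^i(t,x,u,v,dy)$$ be generators of Lévy–Khintchine type on $\mathbb R^d$ with controls $u\in U$, $v\in V$ and times $t\in[0,T]$ ($G^i$ symmetric and nonnegative, $\nu^i(\{0\})=0$, $\int\min\{1,\|y\|^2\}\,d\nu^i<\infty$, $B_1$ the closed unit ball). Put $$\Sigma^i=\operatorname{tr}G^i+\int\|y\|^2\,\nu^i(dy),\qquad b^i=f^i+\int_{\mathbb R^d\setminus B_1}y\,\nu^i(dy).$$ Assume, for $i=1,2$, that $G^i,f^i$ are continuous and $\nu^i$ is weakly continuous in $(t,x,u,v)$ (tested on bounded continuous functions vanishing near $0$); that $\|b^i(t,x,u,v)-b^i(s,x,u,v)\|^2\le\alpha^i(t-s)$ for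 some $\alpha^i:\mathbb R\to[0,\infty)$ with $\alpha^i(\delta)\to0$ as $\delta\to0$; that $\int\|y\|^2\,d\nu^i<\infty$, $|\Sigma^i|\le M_0^i$, $\|b^i\|\le M_1^i$; and that $b^i$ is $K^i$-Lipschitz in $x$. Let $g:\mathbb R^d\to\mathbb R$ be $R$-Lipschitz. Assume the Isaacs condition $$\inf_u\sup_v\langle\xi,b^i(t,x,u,v)\rangle=\sup_v\inf_u\langle\xi,b^i(t,x,u,v)\rangle\quad\text{for all }t\in[0,T],\ x,\xi\in\mathbb R^d$$ for $i=1$ or for $i=2$. Put $$\varkappa=\sup_{t,x,u,v}\|b^1-b^2\|^2,\qquad\Theta=\varkappa+M_0^1+M_0^2,\qquad C=\sqrt{Te^{\beta T}},$$ where $\beta=2+2K^1$ if the Isaacs condition holds for $i=1$ and $\beta=2+2K^2$ otherwise. Let $\mathcal D^1,\mathcal D^2$ be sets of $C^2$ functions on $\mathbb R^d$ containing $C^2_b(\mathbb R^d)$ and all functions $x\mapsto\|x-a\|^2$, $a\in\mathbb R^d$. *Strategies.* Let $\mathbb D_{t_0}$ be the set of càdlàg functions $[t_0,T]\to\mathbb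 R^d$, with the $\sigma$-algebras $\mathbb F_{t_0,s}$ generated by the evaluations at times in $[t_0,s]$. A strategy $\mathfrak u=(\Omega^U,\mathcal F^U,\{\mathcal F^U_s\},u_{x(\cdot)},P^U_{x(\cdot)})$ of the first player on $[t_0,T]$ consists of a filtered measurable space and, for each $x(\cdot)\in\mathbb D_{t_0}$, a progressively measurable $U$-valued process $u_{x(\cdot)}$ and a probability $P^U_{x(\cdot)}$ on $\Omega^U$ such that: if $x=y$ on $[t_0,t]$, then $P^U_{x(\cdot)}=P^U_{y(\cdot)}$ on $\mathcal F^U_t$ and $u_{x(\cdot)}(s)=u_{y(\cdot)}(s)$ $P^U_{x(\cdot)}$-a.s. for each $s\in[t_0,t]$; and, for each $t$, the map $(x(\cdot),s,\omega)\mapsto u_{x(\cdot)}(s,\omega)$ on $\mathbb D_{t_0}\times[t_0,t]\times\Omega^U$ is $\mathbb F_{t_0,t}\otimes\mathcal B([t_0,t])\otimes\mathcal F^U_t$-measurable. It is stepwise if there is a partition $\Delta$ of $[t_0,T]$ such that, for every $\tau\in\Delta$, whenever $x,y\in\mathbb D_{t_0}$ agree at the points of $\Delta$ before $\tau$, one has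 $P^U_{x(\cdot)}=P^U_{y(\cdot)}$ on $\mathcal F^U_{\tau-0}$ and $u_{x(\cdot)}=u_{y(\cdot)}$ on $[t_0,\tau)$; it is deterministic if $\Omega^U$ is a single point. Strategies $\mathfrak v$ of the second player are defined in the same way, with values in $V$. *Motions and upper value.* A realization of the motion for $\mathfrak u,\mathfrak v,(t_0,x_0)$ consists of a filtered space $(\Omega^X,\mathcal F^X,\{\mathcal F^X_s\})$, a probability $P$ on $\Omega^X\times\Omega^U\times\Omega^V$, and a process $X$ with paths in $\mathbb D_{t_0}$, adapted to $\mathcal F_s=\mathcal F^X_s\otimes\mathcal F^U_s\otimes\mathcal F^V_s$, with $X(t_0)=x_0$ a.s., such that for every $\varphi\in\mathcal D^1$ the process $$\varphi(X(t))-\int_{t_0}^tL^1_\tau[u_{X(\cdot)}(\tau),v_{X(\cdot)}(\tau)]\varphi(X(\tau))\,d\tau$$ is an $\{\mathcal F_s\}$-martingale, and $\mathbb E(\zeta'\mid X(\cdot)=x(\cdot))=\int\zeta'\,dP^U_{x(\cdot)}$, $\mathbb E(\zeta''\mid X(\cdot)=x(\cdot))=\int\zeta''\,dP^V_{x(\cdot)}$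 for all bounded random variables $\zeta'$ on $\Omega^U$ and $\zeta''$ on $\Omega^V$. Let $J^*(t_0,x_0,\mathfrak u,\mathfrak v)\in[-\infty,\infty]$ be the supremum of $\mathbb E g(X(T))$ over all realizations ($\sup\emptyset=-\infty$), and let $$\mathrm{Val}_+(t_0,x_0)=\inf_{\mathfrak u}\sup_{\mathfrak v}J^*(t_0,x_0,\mathfrak u,\mathfrak v).$$ *Stability.* A function $c_+:[0,T]\times\mathbb R^d\to\mathbb R$ is $u$-stable with respect to $L^2$ if $c_+(T,\cdot)=g$ and for all $0\le t<\theta\le T$ there are a filtered space $(\widetilde\Omega,\widetilde{\mathcal F},\{\widetilde{\mathcal F}_s\}_{s\in[t,\theta]})$ and, for all $\xi\in\mathbb R^d$, $v\in V$, a progressively measurable process $\mu_{\xi,v}$ with values in the Borel probabilities on $U$, a progressively measurable $\mathbb R^d$-valued process $Y_{\xi,v}$ and a probability $\widetilde P_{\xi,v}$ on $\widetilde\Omega$ such that $Y_{\xi,v}(t)=\xi$ a.s.; for every $\varphi\in\mathcal D^2$ the process $$\varphi(Y_{\xi,v}(s))-\int_t^s\int_UL^2_\tau[w,v]\varphi(Y_{\xi,v}(\tau))\,\mu_{\xi,v}(\tau,dw)\,d\tau$$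 is a martingale; $c_+(t,\xi)\ge\widetilde{\mathbb E}_{\xi,v}c_+(\theta,Y_{\xi,v}(\theta))$; and $(\xi,v)\mapsto\widetilde{\mathbb E}_{\xi,v}\phi$ and $(\xi,v,s)\mapsto\widetilde{\mathbb E}_{\xi,v}\varphi(Y_{\xi,v}(s))$ are measurable for all bounded random variables $\phi$ on $\widetilde\Omega$ and all $\varphi\in\mathcal D^2$. All these expectations and time integrals are required to exist. **Statement.** If $c_+$ is $u$-stable with respect to $L^2$, then for every $(t_0,x_0)\in[0,T]\times\mathbb R^d$ $$\mathrm{Val}_+(t_0,x_0)\le c_+(t_0,x_0)+R\cdot C\sqrt{\Theta}.$$ Moreover, for every $\varepsilon>0$ the first player has a stepwise deterministic strategy $\mathfrak u$ such that $\mathbb Eg(X(T))\le c_+(t_0,x_0)+R\cdot C\sqrt{\Theta}+\varepsilon$ for every strategy $\mathfrak v$ of the second player and every realization of the motion for $\mathfrak u,\mathfrak v,(t_0,x_0)$. -/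

import Mathlib

open MeasureTheory ProbabilityTheory Set Filter Topology
open scoped NNReal ENNReal

noncomputable section

namespace StochGame

/-- The state space `ℝ^d` with its Euclidean norm. -/
abbrev St (d : ℕ) : Type := EuclideanSpace ℝ (Fin d)

/-- The coefficients `(G, f, ν)` of a controlled generator of Lévy-Khintchine type. Only their
values at times in `[0, T]` are ever used. -/
structure Coefficients (d : ℕ) (U V : Type*) where
  G : ℝ → St d → U → V → Matrix (Fin d) (Fin d) ℝ
  f : ℝ → St d → U → V → St d
  ν : ℝ → St d → U → V → Measure (St d)

namespace Coefficients

variable {d : ℕ} {U V : Type*} (L : Coefficients d U V)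

/-- The generator `L_t[u,v] φ (x)`: second order part, drift part, and jump part compensated on
the unit ball. -/
def gen (t : ℝ) (u : U) (v : V) (φ : St d → ℝ) (x : St d) : ℝ :=
  1 / 2 * ∑ i, ∑ j, L.G t x u v i j *
      fderiv ℝ (fderiv ℝ φ) x (EuclideanSpace.single i 1) (EuclideanSpace.single j 1)
    + fderiv ℝ φ x (L.f t x u v)
    + ∫ y, (φ (x + y) - φ x
        - (Metric.closedBall (0 : St d) 1).indicator (fun z => fderiv ℝ φ x z) y) ∂(L.ν t x u v)

/-- `Σ(t,x,u,v) = ∑ⱼ Gⱼⱼ + ∫ ‖y‖² ν(dy)`. -/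
def spread (t : ℝ) (x : St d) (u : U) (v : V) : ℝ :=
  (L.G t x u v).trace + ∫ y, ‖y‖ ^ 2 ∂(L.ν t x u v)

/-- `b(t,x,u,v) = f + ∫ y ν(dy)`, the integral being over the complement of the unit ball. -/
def drift (t : ℝ) (x : St d) (u : U) (v : V) : St d :=
  L.f t x u v + ∫ y in (Metric.closedBall (0 : St d) 1)ᶜ, y ∂(L.ν t x u v)

/-- The requirements on the coefficients of a Lévy-Khintchine generator. -/
def IsLevyKhintchine (T : ℝ) : Prop :=
  ∀ t ∈ Icc 0 T, ∀ (x : St d) (u : U) (v : V),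
    (L.G t x u v).PosSemidef ∧ L.ν t x u v {0} = 0 ∧
      ∫⁻ y, ENNReal.ofReal (min 1 (‖y‖ ^ 2)) ∂(L.ν t x u v) < ∞

/-- The regularity conditions on a generator, with the bounds `M0` (for `Σ`), `M1` (for `b`)
and the Lipschitz constant `K` (of `b` in the state). -/
structure IsRegular [MetricSpace U] [MetricSpace V] (T M0 M1 : ℝ) (K : ℝ≥0) : Prop where
  levyKhintchine : L.IsLevyKhintchine T
  continuous_G : ContinuousOn (fun p : ℝ × St d × U × V => L.G p.1 p.2.1 p.2.2.1 p.2.2.2)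
    (Icc 0 T ×ˢ univ)
  continuous_f : ContinuousOn (fun p : ℝ × St d × U × V => L.f p.1 p.2.1 p.2.2.1 p.2.2.2)
    (Icc 0 T ×ˢ univ)
  /-- Weak continuity of a family of Lévy measures: the test functions are the bounded continuous
  functions that vanish near the origin. -/
  weaklyContinuous_ν : ∀ h : St d → ℝ, Continuous h → (∃ M, ∀ y, |h y| ≤ M) →
    (∀ᶠ y in 𝓝 0, h y = 0) →
    ContinuousOn (fun p : ℝ × St d × U × V => ∫ y, h y ∂(L.ν p.1 p.2.1 p.2.2.1 p.2.2.2))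
      (Icc 0 T ×ˢ univ)
  modulus : ∃ α : ℝ → ℝ, (∀ δ, 0 ≤ α δ) ∧ Tendsto α (𝓝[≠] 0) (𝓝 0) ∧
    ∀ t ∈ Icc 0 T, ∀ s ∈ Icc 0 T, ∀ (x : St d) (u : U) (v : V),
      ‖L.drift t x u v - L.drift s x u v‖ ^ 2 ≤ α (t - s)
  bounded : ∀ t ∈ Icc 0 T, ∀ (x : St d) (u : U) (v : V),
    Integrable (fun y => ‖y‖ ^ 2) (L.ν t x u v) ∧ |L.spread t x u v| ≤ M0 ∧
      ‖L.drift t x u v‖ ≤ M1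
  lipschitz : ∀ t ∈ Icc 0 T, ∀ (u : U) (v : V), LipschitzWith K fun x => L.drift t x u v

/-- The Isaacs condition for the drift `b`. -/
def Isaacs (T : ℝ) : Prop :=
  ∀ t ∈ Icc 0 T, ∀ x ξ : St d,
    ⨅ u : U, ⨆ v : V, inner ℝ ξ (L.drift t x u v) = ⨆ v : V, ⨅ u : U, inner ℝ ξ (L.drift t x u v)

end Coefficients

/-- `𝒟` is a set of `C²` functions that contains `C_b²(ℝ^d)` and the functions `x ↦ ‖x - a‖²`. -/
structure IsTestClass {d : ℕ} (𝒟 : Set (St d → ℝ)) : Prop where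
  contDiff : ∀ φ ∈ 𝒟, ContDiff ℝ 2 φ
  bounded_mem : ∀ φ : St d → ℝ, ContDiff ℝ 2 φ →
    (∃ M, ∀ x, |φ x| ≤ M ∧ ‖fderiv ℝ φ x‖ ≤ M ∧ ‖fderiv ℝ (fderiv ℝ φ) x‖ ≤ M) → φ ∈ 𝒟
  quadratic_mem : ∀ a : St d, (fun x => ‖x - a‖ ^ 2) ∈ 𝒟

/-! ### Càdlàg paths -/

/-- The càdlàg functions from `[t₀, T]` to `ℝ^d`. -/
def Path (d : ℕ) (t₀ T : ℝ) : Type :=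
  {x : Icc t₀ T → St d //
    ∀ s, ContinuousWithinAt x (Ici s) s ∧ ∃ l, Tendsto x (𝓝[<] s) (𝓝 l)}

instance {d : ℕ} {t₀ T : ℝ} : CoeFun (Path d t₀ T) (fun _ => Icc t₀ T → St d) := ⟨Subtype.val⟩

/-- The Borel σ-algebra of the Skorokhod space, which is generated by the evaluations. -/
instance {d : ℕ} {t₀ T : ℝ} : MeasurableSpace (Path d t₀ T) :=
  ⨆ r : Icc t₀ T, MeasurableSpace.comap (fun x => x r) inferInstance

/-- The flow `𝔽_{t₀,s}`, generated by the evaluations at times in `[t₀, s]`. -/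
def pathFiltration (d : ℕ) (t₀ T : ℝ) :
    Filtration (Icc t₀ T) (inferInstance : MeasurableSpace (Path d t₀ T)) where
  seq s := ⨆ r : Icc t₀ T, ⨆ _ : r ≤ s,
    MeasurableSpace.comap (fun x : Path d t₀ T => x r) inferInstance
  mono' _ _ h := iSup_mono fun _ => iSup_mono' fun hr => ⟨hr.trans h, le_rfl⟩
  le' _ := iSup_le fun r => iSup_le fun _ =>
    le_iSup (fun r : Icc t₀ T =>
      MeasurableSpace.comap (fun x : Path d t₀ T => x r) inferInstance) r

/-- The product filtration `ℱ_s ⊗ 𝒢_s`. -/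
def prodFiltration {ι Ω Ω' : Type*} [Preorder ι] {m : MeasurableSpace Ω} {m' : MeasurableSpace Ω'}
    (ℱ : Filtration ι m) (𝒢 : Filtration ι m') : Filtration ι (m.prod m') where
  seq s := (ℱ s).prod (𝒢 s)
  mono' _ _ h := sup_le_sup (MeasurableSpace.comap_mono (ℱ.mono h))
    (MeasurableSpace.comap_mono (𝒢.mono h))
  le' s := sup_le_sup (MeasurableSpace.comap_mono (ℱ.le s)) (MeasurableSpace.comap_mono (𝒢.le s))

/-! ### Strategies and motions -/

/-- A (randomized, with memory) strategy on `[t₀, T]` of a player whose control set is `A`. -/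
structure Strategy (d : ℕ) (A : Type*) [TopologicalSpace A] [MeasurableSpace A] (t₀ T : ℝ) where
  Ω : Type
  mΩ : MeasurableSpace Ω
  ℱ : Filtration (Icc t₀ T) mΩ
  control : Path d t₀ T → Icc t₀ T → Ω → A
  P : Path d t₀ T → Measure Ω
  isProbability : ∀ x, IsProbabilityMeasure (P x)
  progressive : ∀ x, IsStronglyProgressive ℱ (control x)
  nonanticipating : ∀ (t : Icc t₀ T) (x y : Path d t₀ T), (∀ s ≤ t, x s = y s) →
    (∀ A : Set Ω, MeasurableSet[ℱ t] A → P x A = P y A) ∧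
      ∀ s ≤ t, ∀ᵐ ω ∂(P x), control x s ω = control y s ω
  measurable_control : ∀ t : Icc t₀ T,
    Measurable[(pathFiltration d t₀ T t).prod (Subtype.instMeasurableSpace.prod (ℱ t))]
      fun p : Path d t₀ T × Iic t × Ω => control p.1 p.2.1 p.2.2

attribute [instance] Strategy.mΩ

/-- Stepwise strategies: for some partition `Δ` of `[t₀, T]`, what happens before a time `τ` of
the partition depends on the path only through its values at the earlier times of `Δ`. -/
def Strategy.IsStepwise {d : ℕ} {A : Type*} [TopologicalSpace A] [MeasurableSpace A] {t₀ T : ℝ}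
    (𝔲 : Strategy d A t₀ T) : Prop :=
  ∃ Δ : Finset (Icc t₀ T), (∀ s : Icc t₀ T, (s : ℝ) = t₀ ∨ (s : ℝ) = T → s ∈ Δ) ∧
    ∀ τ ∈ Δ, ∀ x y : Path d t₀ T, (∀ r ∈ Δ, r < τ → x r = y r) →
      (∀ B : Set 𝔲.Ω, MeasurableSet[⨆ s : Icc t₀ T, ⨆ _ : s < τ, 𝔲.ℱ s] B → 𝔲.P x B = 𝔲.P y B) ∧
        ∀ s < τ, ∀ ω, 𝔲.control x s ω = 𝔲.control y s ω

/-- Deterministic strategies: the sample space of the strategy is one point. -/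
def Strategy.IsDeterministic {d : ℕ} {A : Type*} [TopologicalSpace A] [MeasurableSpace A]
    {t₀ T : ℝ} (𝔲 : Strategy d A t₀ T) : Prop :=
  Subsingleton 𝔲.Ω

section Game

variable {d : ℕ} {U V : Type*} [MetricSpace U] [MeasurableSpace U] [MetricSpace V]
  [MeasurableSpace V]

/-- A realization of the motion generated by the strategies `𝔲`, `𝔳` and the initial position
`(t₀, x₀)`, for the dynamics `L` with test class `𝒟`. -/
structure Motion (L : Coefficients d U V) (𝒟 : Set (St d → ℝ)) {t₀ T : ℝ} (h : t₀ ≤ T)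
    (x₀ : St d) (𝔲 : Strategy d U t₀ T) (𝔳 : Strategy d V t₀ T) where
  Ω : Type
  mΩ : MeasurableSpace Ω
  ℱ : Filtration (Icc t₀ T) mΩ
  X : Ω × 𝔲.Ω × 𝔳.Ω → Path d t₀ T
  P : Measure (Ω × 𝔲.Ω × 𝔳.Ω)
  isProbability : IsProbabilityMeasure P
  adapted : ∀ s, Measurable[prodFiltration ℱ (prodFiltration 𝔲.ℱ 𝔳.ℱ) s] fun ω => X ω s
  initial : ∀ᵐ ω ∂P, X ω ⟨t₀, left_mem_Icc.2 h⟩ = x₀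
  martingale : ∀ φ ∈ 𝒟, Martingale
    (fun (t : Icc t₀ T) ω => φ (X ω t) - ∫ r in t₀..t,
      L.gen r (𝔲.control (X ω) (projIcc t₀ T h r) ω.2.1)
        (𝔳.control (X ω) (projIcc t₀ T h r) ω.2.2) φ (X ω (projIcc t₀ T h r)))
    (prodFiltration ℱ (prodFiltration 𝔲.ℱ 𝔳.ℱ)) P
  /-- The conditional law of the first player's randomization given `X = x` is `𝔲.P x`. -/
  condExp_fst : ∀ ζ : 𝔲.Ω → ℝ, Measurable ζ → (∃ M, ∀ ω, |ζ ω| ≤ M) →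
    P[fun ω => ζ ω.2.1 | MeasurableSpace.comap X inferInstance]
      =ᵐ[P] fun ω => ∫ w, ζ w ∂(𝔲.P (X ω))
  /-- The conditional law of the second player's randomization given `X = x` is `𝔳.P x`. -/
  condExp_snd : ∀ ζ : 𝔳.Ω → ℝ, Measurable ζ → (∃ M, ∀ ω, |ζ ω| ≤ M) →
    P[fun ω => ζ ω.2.2 | MeasurableSpace.comap X inferInstance]
      =ᵐ[P] fun ω => ∫ w, ζ w ∂(𝔳.P (X ω))

/-- The expected payoff `𝔼 g(X(T))` of a realization. -/
def Motion.payoff {L : Coefficients d U V} {𝒟 : Set (St d → ℝ)} {t₀ T : ℝ} {h : t₀ ≤ T}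
    {x₀ : St d} {𝔲 : Strategy d U t₀ T} {𝔳 : Strategy d V t₀ T} (m : Motion L 𝒟 h x₀ 𝔲 𝔳)
    (g : St d → ℝ) : ℝ :=
  letI := m.mΩ
  ∫ ω, g (m.X ω ⟨T, right_mem_Icc.2 h⟩) ∂m.P

/-- The upper outcome `J^*(t₀, x₀, 𝔲, 𝔳)`. -/
def upperOutcome (L : Coefficients d U V) (𝒟 : Set (St d → ℝ)) (g : St d → ℝ) {t₀ T : ℝ}
    (h : t₀ ≤ T) (x₀ : St d) (𝔲 : Strategy d U t₀ T) (𝔳 : Strategy d V t₀ T) : EReal :=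
  ⨆ m : Motion L 𝒟 h x₀ 𝔲 𝔳, (m.payoff g : EReal)

/-- The upper value `Val₊(t₀, x₀)`. -/
def upperValue (L : Coefficients d U V) (𝒟 : Set (St d → ℝ)) (g : St d → ℝ) {t₀ T : ℝ}
    (h : t₀ ≤ T) (x₀ : St d) : EReal :=
  ⨅ 𝔲 : Strategy d U t₀ T, ⨆ 𝔳 : Strategy d V t₀ T, upperOutcome L 𝒟 g h x₀ 𝔲 𝔳

/-- The data of the stability condition on `[t, θ]`: a filtered space, and for every starting
point `ξ` and every constant control `v` of the second player a generalized control `μ` of the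
first player, a process `Y` and a probability. -/
structure StabilityData (d : ℕ) (U V : Type*) [MetricSpace U] [MeasurableSpace U] [BorelSpace U]
    (t θ : ℝ) where
  Ω : Type
  mΩ : MeasurableSpace Ω
  ℱ : Filtration (Icc t θ) mΩ
  μ : St d → V → Icc t θ → Ω → ProbabilityMeasure U
  Y : St d → V → Icc t θ → Ω → St d
  P : St d → V → Measure Ω

attribute [instance] StabilityData.mΩ

/-- The integrand `∫_U L_r[w, v] φ(Y(r)) μ(r, dw)`. -/
def StabilityData.rate [BorelSpace U] {t θ : ℝ} (S : StabilityData d U V t θ) (h : t ≤ θ)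
    (L : Coefficients d U V) (φ : St d → ℝ) (ξ : St d) (v : V) (ω : S.Ω) (r : ℝ) : ℝ :=
  ∫ w, L.gen r w v φ (S.Y ξ v (projIcc t θ h r) ω)
    ∂(S.μ ξ v (projIcc t θ h r) ω : Measure U)

/-- The requirements on the stability data. The expectations and time integrals that occur are
required to exist. -/
structure StabilityData.IsAdmissible [BorelSpace U] {t θ : ℝ} (S : StabilityData d U V t θ)
    (h : t ≤ θ) (L : Coefficients d U V) (𝒟 : Set (St d → ℝ)) (c : ℝ → St d → ℝ) : Prop where
  isProbability : ∀ ξ v, IsProbabilityMeasure (S.P ξ v)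
  progressive_μ : ∀ ξ v, IsStronglyProgressive S.ℱ (S.μ ξ v)
  progressive_Y : ∀ ξ v, IsStronglyProgressive S.ℱ (S.Y ξ v)
  initial : ∀ ξ v, ∀ᵐ ω ∂(S.P ξ v), S.Y ξ v ⟨t, left_mem_Icc.2 h⟩ ω = ξ
  integrable_rate : ∀ φ ∈ 𝒟, ∀ ξ v, ∀ᵐ ω ∂(S.P ξ v),
    IntervalIntegrable (S.rate h L φ ξ v ω) volume t θ
  martingale : ∀ φ ∈ 𝒟, ∀ ξ v, Martingale
    (fun (s : Icc t θ) ω => φ (S.Y ξ v s ω) - ∫ r in t..s, S.rate h L φ ξ v ω r) S.ℱ (S.P ξ v)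
  integrable_c : ∀ ξ v, Integrable (fun ω => c θ (S.Y ξ v ⟨θ, right_mem_Icc.2 h⟩ ω)) (S.P ξ v)
  decrease : ∀ ξ v, ∫ ω, c θ (S.Y ξ v ⟨θ, right_mem_Icc.2 h⟩ ω) ∂(S.P ξ v) ≤ c t ξ
  measurable_P : ∀ ζ : S.Ω → ℝ, Measurable ζ → (∃ M, ∀ ω, |ζ ω| ≤ M) →
    Measurable fun p : St d × V => ∫ ω, ζ ω ∂(S.P p.1 p.2)
  integrable_test : ∀ φ ∈ 𝒟, ∀ ξ v s, Integrable (fun ω => φ (S.Y ξ v s ω)) (S.P ξ v)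
  measurable_test : ∀ φ ∈ 𝒟,
    Measurable fun p : St d × V × Icc t θ => ∫ ω, φ (S.Y p.1 p.2.1 p.2.2 ω) ∂(S.P p.1 p.2.1)

/-- `c` is `u`-stable with respect to the generator `L`. -/
def IsUStable [BorelSpace U] (T : ℝ) (L : Coefficients d U V) (𝒟 : Set (St d → ℝ))
    (g : St d → ℝ) (c : ℝ → St d → ℝ) : Prop :=
  (∀ x, c T x = g x) ∧
    ∀ (t θ : ℝ) (_ : 0 ≤ t) (h : t < θ) (_ : θ ≤ T),
      ∃ S : StabilityData d U V t θ, S.IsAdmissible h.le L 𝒟 c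

/-- `ϰ = sup ‖b¹ - b²‖²`. -/
def kappa (T : ℝ) (L₁ L₂ : Coefficients d U V) : ℝ :=
  ⨆ p : Icc 0 T × St d × U × V,
    ‖L₁.drift p.1 p.2.1 p.2.2.1 p.2.2.2 - L₂.drift p.1 p.2.1 p.2.2.1 p.2.2.2‖ ^ 2

open Classical in
/-- `β = 2 + 2 Kⁱ`, with `i = 1` if the Isaacs condition holds for `b¹`, and `i = 2` otherwise. -/
def beta (T : ℝ) (L₁ : Coefficients d U V) (K₁ K₂ : ℝ≥0) : ℝ :=
  2 + 2 * (if L₁.Isaacs T then (K₁ : ℝ) else (K₂ : ℝ))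

/-- `C = √(T e^{βT})`. -/
def constC (T : ℝ) (L₁ : Coefficients d U V) (K₁ K₂ : ℝ≥0) : ℝ :=
  √(T * Real.exp (beta T L₁ K₁ K₂ * T))

/-- `Θ = ϰ + M₀¹ + M₀²`. -/
def Theta (T : ℝ) (L₁ L₂ : Coefficients d U V) (M0₁ M0₂ : ℝ) : ℝ :=
  kappa T L₁ L₂ + M0₁ + M0₂

end Game

end StochGame

end

/-!
The first player aims proximally. For `p > 0` put `p_t = p e^{β(T-t)}` and consider the
inf-convolution `w(t, x) = inf_y (c(t, y) + p_t ‖x - y‖²)`. Stability and the Lipschitz property of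
`g` bound `c` from below (`IsUStable.exists_sub_le`), so `w` is finite; it is a quadratic plus a
concave function of `x`, hence continuous although `c` need not even be measurable.

At a node `t` of the partition the first player observes `z = X(t)`, takes an almost minimizing
`y`, and plays until the next node the control that is extremal for the Isaacs game in the
direction `z - y` (`exists_extremal`). The opposite extremal control `v` of the second player
selects a guide `Y` started at `y`, to which stability applies. In the comparison of `X` with an
independent copy of `Y`, the identity `L ‖· - m‖² = Σ + 2 ⟨· - m, b⟩` (`Coefficients.gen_sq_dist`)
gives, over a step of length `h`,
`𝔼 ‖X - Y‖² ≤ (1 + β h) ‖z - y‖² + h Θ + o(h)`, with `o(h)` uniform in `z` and `y`: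
the Isaacs condition and the Lipschitz constant yield `2 K ‖z - y‖²`, and Young's inequality
absorbs the discrepancy of the drifts and the errors into `2 ‖z - y‖²`. Hence `𝔼 w(t, X(t))`
increases by at most `p e^{βT} (Θ h + o(h))` (`exists_step_control`). No coupling of the motion
with the guide is carried from step to step, so the strategy is a deterministic function of the
observed states. Continuity of `w` allows the state space to be cut into countably many pieces on
which `y` and the control are constant, which settles measurability.

At time `T` one has `g ≤ w(T, ·) + R² / (4 p)`. Summation over the steps gives
`𝔼 g(X(T)) ≤ c(t₀, x₀) + p T e^{βT} Θ + R² / (4 p)` up to `o(1)`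
(`exists_strategy_payoff_le`), and the choice of `p` yields `R C √Θ`
(`exists_strategy_payoff_le_add`).

Motions and guides enter only through `QuadDyn`: joint measurability, bounded spread and drift, and
the martingale property of the squared distances. That second moments are finite is part of the
proof (`QuadDyn.exists_integral_sq_le`), since for motions only the martingales are known to be
integrable.
-/

namespace StochGame

/-! ### The generator on squared distances -/

variable {d : ℕ} {U V : Type*}

namespace Coefficients

/-- On squared distances the generator is affine in `(Σ, b)`. -/
theorem gen_sq_dist (L : Coefficients d U V) {t : ℝ} {u : U} {v : V} {x : St d}
    (hν : Integrable (fun y => ‖y‖ ^ 2) (L.ν t x u v)) (m : St d) :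
    L.gen t u v (fun z => ‖z - m‖ ^ 2) x
      = L.spread t x u v + 2 * inner ℝ (x - m) (L.drift t x u v) := by
  have h1 : ∀ z : St d, HasFDerivAt (fun z : St d => ‖z - m‖ ^ 2) (2 • innerSL ℝ (z - m)) z := by
    intro z
    have := ((hasFDerivAt_id z).sub_const m).norm_sq
    simpa using this
  have h2 : fderiv ℝ (fun z : St d => ‖z - m‖ ^ 2) = fun z => 2 • innerSL ℝ (z - m) :=
    funext fun z => (h1 z).fderiv
  have h3 : fderiv ℝ (fun z : St d => 2 • innerSL ℝ (z - m)) x = 2 • innerSL ℝ := by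
    have h : HasFDerivAt (fun z : St d => 2 • innerSL ℝ (z - m))
        (2 • (innerSL ℝ : St d →L[ℝ] St d →L[ℝ] ℝ)) x := by
      have := ((innerSL ℝ : St d →L[ℝ] St d →L[ℝ] ℝ).hasFDerivAt (x := x - m)).comp x
        ((hasFDerivAt_id x).sub_const m)
      exact this.const_smul 2
    exact h.fderiv
  have htr : 1 / 2 * ∑ i, ∑ j, L.G t x u v i j *
      (2 • (innerSL ℝ : St d →L[ℝ] St d →L[ℝ] ℝ)) (EuclideanSpace.single i 1)
        (EuclideanSpace.single j 1) = (L.G t x u v).trace := by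
    have : ∀ i j : Fin d, L.G t x u v i j *
      (2 • (innerSL ℝ : St d →L[ℝ] St d →L[ℝ] ℝ)) (EuclideanSpace.single i 1)
        (EuclideanSpace.single j 1) = if j = i then 2 * L.G t x u v i i else 0 := by
      intro i j
      by_cases h : j = i
      · subst h; simp [mul_comm]
      · simp [h, EuclideanSpace.inner_single_left]
    simp_rw [this]
    simp [Matrix.trace, Finset.mul_sum]
  set B := Metric.closedBall (0 : St d) 1
  have hB : MeasurableSet Bᶜ := Metric.isClosed_closedBall.measurableSet.compl
  have hint : Integrable (Bᶜ.indicator fun y : St d => y) (L.ν t x u v) := by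
    refine hν.mono ((measurable_id.indicator hB).aestronglyMeasurable) (Eventually.of_forall ?_)
    intro y
    by_cases hy : y ∈ Bᶜ
    · have : 1 < ‖y‖ := by simpa [B] using hy
      rw [indicator_of_mem hy, Real.norm_eq_abs, abs_of_nonneg (by positivity)]
      nlinarith
    · rw [indicator_of_notMem hy]; simp
  have hjump : ∀ y : St d, ‖x + y - m‖ ^ 2 - ‖x - m‖ ^ 2
      - B.indicator (fun z => (2 • innerSL ℝ (x - m)) z) y
      = ‖y‖ ^ 2 + 2 * inner ℝ (x - m) (Bᶜ.indicator (fun y => y) y) := by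
    intro y
    have e : ‖x + y - m‖ ^ 2 = ‖x - m‖ ^ 2 + 2 * inner ℝ (x - m) y + ‖y‖ ^ 2 := by
      rw [show x + y - m = (x - m) + y by abel, norm_add_sq_real]
    by_cases hy : y ∈ B
    · rw [indicator_of_mem hy, indicator_of_notMem (by simpa using hy), e]
      simp only [smul_apply, innerSL_apply_apply, nsmul_eq_mul, inner_zero_right]
      push_cast; ring
    · rw [indicator_of_notMem hy, indicator_of_mem (by simpa using hy), e]; simp; ring
  have hi2 : Integrable (fun y => 2 * inner ℝ (x - m) (Bᶜ.indicator (fun y => y) y))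
      (L.ν t x u v) := (hint.const_inner (x - m)).const_mul 2
  unfold gen
  rw [h2, h3, htr]
  rw [show (∫ y, (‖x + y - m‖ ^ 2 - ‖x - m‖ ^ 2 - (Metric.closedBall (0 : St d) 1).indicator
      (fun z => (2 • innerSL ℝ (x - m)) z) y) ∂(L.ν t x u v)) = _ from
    integral_congr_ae (Eventually.of_forall hjump)]
  rw [integral_add hν hi2, integral_const_mul, integral_inner hint, integral_indicator hB]
  have hf : (2 • innerSL ℝ (x - m)) (L.f t x u v) = 2 * inner ℝ (x - m) (L.f t x u v) := by
    simp only [smul_apply, innerSL_apply_apply, nsmul_eq_mul]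
    push_cast; ring
  simp only [spread, drift, inner_add_right]
  rw [hf, show Metric.closedBall (0 : St d) 1 = B from rfl]
  ring

theorem IsRegular.integrable_compl_ball [MetricSpace U] [MetricSpace V]
    {L : Coefficients d U V} {T M0 M1 : ℝ} {K : ℝ≥0} (hL : L.IsRegular T M0 M1 K) {t : ℝ} (ht : t ∈ Icc 0 T)
    (x : St d) (u : U) (v : V) :
    Integrable (fun y => y) ((L.ν t x u v).restrict (Metric.closedBall (0 : St d) 1)ᶜ) := by
  have hB : MeasurableSet (Metric.closedBall (0 : St d) 1)ᶜ :=
    Metric.isClosed_closedBall.measurableSet.compl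
  refine (hL.bounded t ht x u v).1.restrict.mono measurable_id.aestronglyMeasurable ?_
  filter_upwards [ae_restrict_mem hB] with y hy
  have : 1 < ‖y‖ := by simpa using hy
  rw [Real.norm_eq_abs, abs_of_nonneg (by positivity)]
  nlinarith

section Measurability

variable [MetricSpace U] [CompactSpace U] [MeasurableSpace U] [BorelSpace U]
  [MetricSpace V] [CompactSpace V] [MeasurableSpace V] [BorelSpace V]
  {L : Coefficients d U V} {T M0 M1 : ℝ} {K : ℝ≥0}

/-- Integrals against the Lévy measures of functions that are dominated limits of the admissible
test functions depend measurably on the parameters. -/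
theorem IsRegular.measurable_integral (hL : L.IsRegular T M0 M1 K) {H : ℕ → St d → ℝ}
    {f : St d → ℝ} (hc : ∀ n, Continuous (H n)) (hb : ∀ n, ∃ M, ∀ y, |H n y| ≤ M)
    (h0 : ∀ n, ∀ᶠ y in 𝓝 0, H n y = 0) (hdom : ∀ n y, |H n y| ≤ ‖y‖ ^ 2)
    (hlim : ∀ y, Tendsto (fun n => H n y) atTop (𝓝 (f y))) :
    Measurable fun p : Icc (0 : ℝ) T × St d × U × V =>
      ∫ y, f y ∂(L.ν p.1 p.2.1 p.2.2.1 p.2.2.2) := by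
  refine measurable_of_tendsto_metrizable (f := fun n (p : Icc (0 : ℝ) T × St d × U × V) =>
    ∫ y, H n y ∂(L.ν p.1 p.2.1 p.2.2.1 p.2.2.2)) (fun n => ?_) (tendsto_pi_nhds.2 fun p => ?_)
  · refine Continuous.measurable ?_
    exact (hL.weaklyContinuous_ν (H n) (hc n) (hb n) (h0 n)).comp_continuous
      (f := fun p : Icc (0 : ℝ) T × St d × U × V => ((p.1 : ℝ), p.2))
      (by fun_prop) (fun p => ⟨p.1.2, mem_univ _⟩)
  · refine tendsto_integral_of_dominated_convergence (fun y => ‖y‖ ^ 2)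
      (fun n => (hc n).aestronglyMeasurable)
      (hL.bounded p.1 p.1.2 p.2.1 p.2.2.1 p.2.2.2).1 (fun n => Eventually.of_forall fun y => ?_)
      (Eventually.of_forall hlim)
    simpa using hdom n y

theorem IsRegular.measurable_spread (hL : L.IsRegular T M0 M1 K) :
    Measurable fun p : Icc (0 : ℝ) T × St d × U × V =>
      L.spread p.1 p.2.1 p.2.2.1 p.2.2.2 := by
  unfold spread
  refine Measurable.add ?_ ?_
  · have h : Continuous fun p : Icc (0 : ℝ) T × St d × U × V =>
        L.G p.1 p.2.1 p.2.2.1 p.2.2.2 :=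
      hL.continuous_G.comp_continuous
        (f := fun p : Icc (0 : ℝ) T × St d × U × V => ((p.1 : ℝ), p.2))
        (by fun_prop) (fun p => ⟨p.1.2, mem_univ _⟩)
    exact h.matrix_trace.measurable
  -- `‖y‖²` is the limit of its truncations, cut off on the balls of radius `1 / (n + 1)`; at `y = 0`
  -- all of them vanish.
  · have hχ0 : ∀ (n : ℕ) (y : St d), 0 ≤ min 1 (max 0 ((n + 1 : ℝ) * ‖y‖ - 1)) :=
      fun n y => le_min zero_le_one (le_max_left _ _)
    have hχ1 : ∀ (n : ℕ) (y : St d), min 1 (max 0 ((n + 1 : ℝ) * ‖y‖ - 1)) ≤ 1 :=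
      fun n y => min_le_left _ _
    have hm0 : ∀ (n : ℕ) (y : St d), 0 ≤ min (‖y‖ ^ 2) (n : ℝ) :=
      fun n y => le_min (by positivity) (by positivity)
    refine hL.measurable_integral
      (H := fun n y => min (‖y‖ ^ 2) (n : ℝ) * min 1 (max 0 ((n + 1 : ℝ) * ‖y‖ - 1)))
      (fun n => by fun_prop) (fun n => ⟨n, fun y => ?_⟩) (fun n => ?_) (fun n y => ?_)
      (fun y => ?_)
    · rw [abs_of_nonneg (mul_nonneg (hm0 n y) (hχ0 n y))]
      calc _ ≤ (n : ℝ) * 1 := mul_le_mul (min_le_right _ _) (hχ1 n y) (hχ0 n y) (by positivity)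
        _ = n := mul_one _
    · have : Metric.ball (0 : St d) (1 / (n + 1)) ∈ 𝓝 (0 : St d) :=
        Metric.ball_mem_nhds _ (by positivity)
      filter_upwards [this] with y hy
      have hy' : ‖y‖ < 1 / (n + 1 : ℝ) := by simpa using hy
      rw [lt_div_iff₀ (by positivity)] at hy'
      rw [max_eq_left (by linarith)]; simp
    · rw [abs_of_nonneg (mul_nonneg (hm0 n y) (hχ0 n y))]
      calc _ ≤ (‖y‖ ^ 2) * 1 := mul_le_mul (min_le_left _ _) (hχ1 n y) (hχ0 n y) (by positivity)
        _ = _ := mul_one _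
    · rcases eq_or_ne y 0 with rfl | hy
      · simp
      · refine tendsto_const_nhds.congr' ?_
        have hy0 : 0 < ‖y‖ := norm_pos_iff.2 hy
        obtain ⟨n0, hn0⟩ := exists_nat_ge (2 / ‖y‖)
        obtain ⟨n1, hn1⟩ := exists_nat_ge (‖y‖ ^ 2)
        filter_upwards [eventually_ge_atTop n0, eventually_ge_atTop n1] with n h0 h1
        have h0' : (n0 : ℝ) ≤ n := by exact_mod_cast h0
        have h1' : (n1 : ℝ) ≤ n := by exact_mod_cast h1
        have h2 : 2 ≤ (n : ℝ) * ‖y‖ := by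
          rw [div_le_iff₀ hy0] at hn0
          nlinarith
        have h3 : (1 : ℝ) ≤ (n + 1) * ‖y‖ - 1 := by nlinarith
        rw [min_eq_left (hn1.trans h1'), min_eq_left (h3.trans (le_max_right _ _)), mul_one]

theorem IsRegular.measurable_drift (hL : L.IsRegular T M0 M1 K) :
    Measurable fun p : Icc (0 : ℝ) T × St d × U × V =>
      L.drift p.1 p.2.1 p.2.2.1 p.2.2.2 := by
  unfold drift
  refine Measurable.add ?_ ?_
  · exact (hL.continuous_f.comp_continuous
        (f := fun p : Icc (0 : ℝ) T × St d × U × V => ((p.1 : ℝ), p.2))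
        (by fun_prop) (fun p => ⟨p.1.2, mem_univ _⟩)).measurable
  set B := Metric.closedBall (0 : St d) 1 with hBdef
  have hB : MeasurableSet Bᶜ := Metric.isClosed_closedBall.measurableSet.compl
  suffices h : ∀ i : Fin d, Measurable fun p : Icc (0 : ℝ) T × St d × U × V =>
      (∫ y in Bᶜ, y ∂(L.ν p.1 p.2.1 p.2.2.1 p.2.2.2)) i by
    have := (MeasurableEquiv.toLp 2 (Fin d → ℝ)).measurable.comp (measurable_pi_iff.2 h)
    exact this
  intro i
  have e : (fun p : Icc (0 : ℝ) T × St d × U × V =>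
      (∫ y in Bᶜ, y ∂(L.ν p.1 p.2.1 p.2.2.1 p.2.2.2)) i) =
      fun p => ∫ y, Bᶜ.indicator (fun y : St d => y i) y ∂(L.ν p.1 p.2.1 p.2.2.1 p.2.2.2) := by
    funext p
    rw [integral_indicator hB]
    exact ((EuclideanSpace.proj i : St d →L[ℝ] ℝ).integral_comp_comm
      (hL.integrable_compl_ball p.1.2 p.2.1 p.2.2.1 p.2.2.2)).symm
  rw [e]
  -- The coordinate, restricted to the complement of the closed unit ball, is the limit of its
  -- truncations times continuous cut-offs that vanish on that ball. There `|y i| ≤ ‖y‖ ≤ ‖y‖²`.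
  have hχ0 : ∀ (n : ℕ) (y : St d), 0 ≤ min 1 (max 0 ((n : ℝ) * (‖y‖ - 1))) :=
    fun n y => le_min zero_le_one (le_max_left _ _)
  have hχ1 : ∀ (n : ℕ) (y : St d), min 1 (max 0 ((n : ℝ) * (‖y‖ - 1))) ≤ 1 :=
    fun n y => min_le_left _ _
  have hχz : ∀ (n : ℕ) (y : St d), ‖y‖ ≤ 1 → min 1 (max 0 ((n : ℝ) * (‖y‖ - 1))) = 0 := by
    intro n y hy
    rw [max_eq_left (mul_nonpos_of_nonneg_of_nonpos (by positivity) (by linarith))]; simp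
  have hcl : ∀ (n : ℕ) (s : ℝ), |max (-n : ℝ) (min n s)| ≤ |s| := by
    intro n s
    have hn : (0 : ℝ) ≤ n := by positivity
    rcases le_total 0 s with hs | hs
    · have : 0 ≤ min (n : ℝ) s := le_min hn hs
      rw [max_eq_right (by linarith), abs_of_nonneg this, abs_of_nonneg hs]
      exact min_le_right _ _
    · rw [min_eq_right (hs.trans hn), abs_of_nonpos hs, abs_of_nonpos (max_le (by linarith) hs)]
      exact neg_le_neg (le_max_right _ _)
  have hcl' : ∀ (n : ℕ) (s : ℝ), |max (-n : ℝ) (min n s)| ≤ n := by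
    intro n s
    have hn : (0 : ℝ) ≤ n := by positivity
    exact abs_le.2 ⟨le_max_left _ _, max_le (by linarith) (min_le_left _ _)⟩
  refine hL.measurable_integral
    (H := fun n y => max (-n : ℝ) (min n (y i)) * min 1 (max 0 ((n : ℝ) * (‖y‖ - 1))))
    (fun n => by fun_prop) (fun n => ⟨n, fun y => ?_⟩) (fun n => ?_) (fun n y => ?_)
    (fun y => ?_)
  · rw [abs_mul, abs_of_nonneg (hχ0 n y)]
    calc _ ≤ (n : ℝ) * 1 := mul_le_mul (hcl' _ _) (hχ1 n y) (hχ0 n y) (by positivity)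
        _ = n := mul_one _
  · filter_upwards [Metric.closedBall_mem_nhds (0 : St d) one_pos] with y hy
    rw [hχz n y (by simpa using hy), mul_zero]
  · rw [abs_mul, abs_of_nonneg (hχ0 n y)]
    rcases le_or_gt ‖y‖ 1 with hy | hy
    · rw [hχz n y hy]; simp
    · have h1 : |y i| ≤ ‖y‖ := by simpa using PiLp.norm_apply_le y i
      calc _ ≤ ‖y‖ * 1 := mul_le_mul ((hcl _ _).trans h1) (hχ1 n y) (hχ0 n y) (by positivity)
        _ ≤ ‖y‖ ^ 2 := by nlinarith
  · rcases le_or_gt ‖y‖ 1 with hy | hy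
    · rw [indicator_of_notMem (by simpa [B] using hy)]
      simp_rw [hχz _ y hy, mul_zero]
      exact tendsto_const_nhds
    · rw [indicator_of_mem (by simpa [B] using hy)]
      refine tendsto_const_nhds.congr' ?_
      have hy0 : 0 < ‖y‖ - 1 := by linarith
      obtain ⟨n0, hn0⟩ := exists_nat_ge (1 / (‖y‖ - 1))
      obtain ⟨n1, hn1⟩ := exists_nat_ge |y i|
      filter_upwards [eventually_ge_atTop n0, eventually_ge_atTop n1] with n h0 h1
      have h0' : (n0 : ℝ) ≤ n := by exact_mod_cast h0
      have h1' : (n1 : ℝ) ≤ n := by exact_mod_cast h1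
      rw [div_le_iff₀ hy0] at hn0
      have h3 : (1 : ℝ) ≤ n * (‖y‖ - 1) := by nlinarith
      have h4 := abs_le.1 (hn1.trans h1')
      rw [min_eq_left (h3.trans (le_max_right _ _)), mul_one, min_eq_right h4.2,
        max_eq_right h4.1]

end Measurability

end Coefficients

/-! ### Processes with bounded spread and drift -/

theorem norm_le_sum_abs (x : St d) : ‖x‖ ≤ ∑ i, |x i| := by
  conv_lhs => rw [← (EuclideanSpace.basisFun (Fin d) ℝ).sum_repr x]
  refine (norm_sum_le _ _).trans (Finset.sum_le_sum fun i _ => ?_)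
  rw [norm_smul]
  simp

/-- The rate of change of `‖X - m‖²` for a process with spread `σ` and drift `β`. -/
noncomputable def quadRate {Ω : Type*} {a b : ℝ} (h : a ≤ b) (X : Icc a b → Ω → St d)
    (σ : ℝ → Ω → ℝ) (β : ℝ → Ω → St d) (m : St d) (r : ℝ) (ω : Ω) : ℝ :=
  σ r ω + 2 * inner ℝ (X (projIcc a b h r) ω - m) (β r ω)

/-- A jointly measurable process `X` on `[a, b]` with bounded spread `σ` and bounded drift `β`, in
the sense that for every centre `m` the process `‖X - m‖²` minus its integrated rate is a
martingale. Both the motion and the guides of the stability condition are of this kind, and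
nothing else about their laws is needed. -/
structure QuadDyn {Ω : Type*} [mΩ : MeasurableSpace Ω] {a b : ℝ} (h : a ≤ b)
    (ℱ : Filtration (Icc a b) mΩ) (P : Measure Ω) (X : Icc a b → Ω → St d)
    (σ : ℝ → Ω → ℝ) (β : ℝ → Ω → St d) (M0 M1 : ℝ) : Prop where
  measurable : Measurable fun p : Icc a b × Ω => X p.1 p.2
  abs_σ_le : ∀ r ∈ Icc a b, ∀ ω, |σ r ω| ≤ M0
  norm_β_le : ∀ r ∈ Icc a b, ∀ ω, ‖β r ω‖ ≤ M1
  integrable : ∀ m, ∀ᵐ ω ∂P, IntervalIntegrable (fun r => quadRate h X σ β m r ω) volume a b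
  martingale : ∀ m, Martingale
    (fun (s : Icc a b) ω => ‖X s ω - m‖ ^ 2 - ∫ r in a..s, quadRate h X σ β m r ω) ℱ P

namespace QuadDyn

variable {Ω : Type*} [mΩ : MeasurableSpace Ω] {a b : ℝ} {h : a ≤ b}
  {ℱ : Filtration (Icc a b) mΩ} {P : Measure Ω}
  {X : Icc a b → Ω → St d} {σ : ℝ → Ω → ℝ} {β : ℝ → Ω → St d} {M0 M1 : ℝ}

theorem measurable_apply (D : QuadDyn h ℱ P X σ β M0 M1) (s : Icc a b) : Measurable (X s) :=
  D.measurable.comp (measurable_const.prodMk measurable_id)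

theorem intervalIntegrable_sub (D : QuadDyn h ℱ P X σ β M0 M1) (m : St d) :
    ∀ᵐ ω ∂P, ∀ s s' : Icc a b,
      IntervalIntegrable (fun r => quadRate h X σ β m r ω) volume s s' := by
  filter_upwards [D.integrable m] with ω hω s s'
  refine hω.mono_set ?_
  rw [uIcc_of_le h]
  exact uIcc_subset_Icc s.2 s'.2

variable [IsProbabilityMeasure P]

/-- First moments are bounded: the difference of two squared distances is affine, and the
resulting martingale differs from a coordinate of `X` by a bounded amount. -/
theorem exists_integral_norm_le (D : QuadDyn h ℱ P X σ β M0 M1) :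
    ∃ B, ∀ s, Integrable (X s) P ∧ ∫ ω, ‖X s ω‖ ∂P ≤ B := by
  have hM1 : ∀ ω : Ω, 0 ≤ M1 := fun ω => (norm_nonneg _).trans (D.norm_β_le a ⟨le_rfl, h⟩ ω)
  have hb : b ∈ Icc a b := ⟨h, le_rfl⟩
  have key : ∀ i : Fin d, ∃ B, ∀ s, Integrable (fun ω => X s ω i) P ∧
      ∫ ω, |X s ω i| ∂P ≤ B := by
    intro i
    set e : St d := EuclideanSpace.single i 1 with he
    set N : Icc a b → Ω → ℝ :=
      (fun (s : Icc a b) ω => ‖X s ω - 0‖ ^ 2 - ∫ r in a..s, quadRate h X σ β 0 r ω) -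
      (fun (s : Icc a b) ω => ‖X s ω - e‖ ^ 2 - ∫ r in a..s, quadRate h X σ β e r ω) with hN
    have hNm : Martingale N ℱ P := (D.martingale 0).sub (D.martingale e)
    have hNb : ∀ s, ∫ ω, |N s ω| ∂P ≤ ∫ ω, |N ⟨b, hb⟩ ω| ∂P := by
      intro s
      have e1 := hNm.condExp_ae_eq (i := s) (j := ⟨b, hb⟩) s.2.2
      rw [← integral_congr_ae (show (fun ω => |(P[N ⟨b, hb⟩ | ℱ s]) ω|) =ᵐ[P] fun ω => |N s ω| from
        e1.fun_comp abs)]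
      exact integral_abs_condExp_le _
    have hbd : ∀ s, ∀ᵐ ω ∂P, |X s ω i| ≤ |N s ω| + (1 + 2 * M1 * (b - a)) := by
      intro s
      filter_upwards [D.intervalIntegrable_sub 0, D.intervalIntegrable_sub e] with ω h0 h1
      have h0' := h0 ⟨a, le_rfl, h⟩ s
      have h1' := h1 ⟨a, le_rfl, h⟩ s
      have e1 : N s ω = 2 * X s ω i - 1 - ∫ r in a..s, 2 * inner ℝ e (β r ω) := by
        have e2 : ∫ r in a..s, 2 * inner ℝ e (β r ω) =
            (∫ r in a..s, quadRate h X σ β 0 r ω) - ∫ r in a..s, quadRate h X σ β e r ω := by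
          rw [← intervalIntegral.integral_sub h0' h1']
          refine intervalIntegral.integral_congr fun r _ => ?_
          simp only [quadRate, sub_zero, inner_sub_left]; ring
        have e3 : ‖X s ω - e‖ ^ 2 = ‖X s ω‖ ^ 2 - 2 * X s ω i + 1 := by
          rw [norm_sub_sq_real]; simp [he, EuclideanSpace.inner_single_right]
        simp only [hN, Pi.sub_apply, e3, sub_zero, e2]
        ring
      have e4 : |∫ r in a..s, 2 * inner ℝ e (β r ω)| ≤ 2 * M1 * (b - a) := by
        have := intervalIntegral.norm_integral_le_of_norm_le_const (a := a) (b := s)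
          (f := fun r => 2 * inner ℝ e (β r ω)) (C := 2 * M1) (fun r hr => ?_)
        · rw [Real.norm_eq_abs, abs_of_nonneg (sub_nonneg.2 s.2.1)] at this
          exact this.trans (mul_le_mul_of_nonneg_left (by linarith [s.2.2])
            (by linarith [hM1 ω]))
        · rw [uIoc_of_le s.2.1] at hr
          have hβ := D.norm_β_le r ⟨hr.1.le, hr.2.trans s.2.2⟩ ω
          have := norm_inner_le_norm (𝕜 := ℝ) e (β r ω)
          rw [norm_mul, Real.norm_ofNat]
          have he1 : ‖e‖ = 1 := by simp [he]
          rw [he1, one_mul] at this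
          linarith
      have e5 : 2 * X s ω i = N s ω + 1 + ∫ r in a..s, 2 * inner ℝ e (β r ω) := by linarith
      rw [abs_le] at e4 ⊢
      have := neg_abs_le (N s ω)
      have := le_abs_self (N s ω)
      have := hM1 ω
      have : 0 ≤ 2 * M1 * (b - a) := by have := sub_nonneg.2 h; positivity
      constructor <;> linarith [abs_nonneg (N s ω)]
    have hint : ∀ s, Integrable (fun ω => |N s ω| + (1 + 2 * M1 * (b - a))) P :=
      fun s => (hNm.integrable s).abs.add (integrable_const _)
    have hXi : ∀ s, Integrable (fun ω => X s ω i) P := fun s =>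
      (hint s).mono' (((EuclideanSpace.proj i : St d →L[ℝ] ℝ).measurable.comp
        (D.measurable_apply s)).aestronglyMeasurable) (hbd s)
    refine ⟨∫ ω, |N ⟨b, hb⟩ ω| ∂P + (1 + 2 * M1 * (b - a)), fun s => ⟨hXi s, ?_⟩⟩
    refine (integral_mono_ae (hXi s).abs (hint s) (hbd s)).trans ?_
    rw [integral_add (hNm.integrable s).abs (integrable_const _)]
    simpa using hNb s
  choose B hB using key
  refine ⟨∑ i, B i, fun s => ?_⟩
  have hi : Integrable (fun ω => ∑ i, |X s ω i|) P :=
    integrable_finsetSum _ fun i _ => (hB i s).1.abs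
  have hX : Integrable (X s) P := hi.mono' (D.measurable_apply s).aestronglyMeasurable
    (Eventually.of_forall fun ω => norm_le_sum_abs _)
  refine ⟨hX, (integral_mono hX.norm hi fun ω => norm_le_sum_abs _).trans ?_⟩
  rw [integral_finsetSum _ fun i _ => (hB i s).1.abs]
  exact Finset.sum_le_sum fun i _ => (hB i s).2

/-- Functions of `X` with bounded expectations are integrable in time and chance. -/
theorem integrable_prod (D : QuadDyn h ℱ P X σ β M0 M1) {f : St d → ℝ} (hf : Measurable f)
    (hf0 : ∀ x, 0 ≤ f x) {B : ℝ}
    (hB : ∀ s, Integrable (fun ω => f (X s ω)) P ∧ ∫ ω, f (X s ω) ∂P ≤ B) :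
    Integrable (fun p : ℝ × Ω => f (X (projIcc a b h p.1) p.2))
      ((volume.restrict (Ioc a b)).prod P) := by
  have hm : Measurable fun p : ℝ × Ω => f (X (projIcc a b h p.1) p.2) :=
    hf.comp (D.measurable.comp
      (((continuous_projIcc (h := h)).measurable.comp measurable_fst).prodMk measurable_snd))
  rw [integrable_prod_iff hm.aestronglyMeasurable]
  refine ⟨Eventually.of_forall fun r => (hB (projIcc a b h r)).1, ?_⟩
  refine Integrable.of_bound (C := B) ?_ (Eventually.of_forall fun r => ?_)
  · exact (hm.norm.stronglyMeasurable.integral_prod_right').aestronglyMeasurable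
  · have h0 : ∀ x, ‖f x‖ = f x := fun x => Real.norm_of_nonneg (hf0 x)
    simp only [h0]
    rw [Real.norm_of_nonneg (integral_nonneg fun ω => hf0 _)]
    exact (hB _).2

/-- Second moments are finite and bounded over the time interval. -/
theorem exists_integral_sq_le (D : QuadDyn h ℱ P X σ β M0 M1) (m : St d) :
    ∃ B, ∀ s, Integrable (fun ω => ‖X s ω - m‖ ^ 2) P ∧ ∫ ω, ‖X s ω - m‖ ^ 2 ∂P ≤ B := by
  obtain ⟨B, hB⟩ := D.exists_integral_norm_le
  have hb : b ∈ Icc a b := ⟨h, le_rfl⟩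
  have hXm : ∀ s, Integrable (fun ω => ‖X s ω - m‖) P ∧ ∫ ω, ‖X s ω - m‖ ∂P ≤ B + ‖m‖ := by
    intro s
    have h1 : Integrable (fun ω => ‖X s ω - m‖) P := ((hB s).1.sub (integrable_const m)).norm
    refine ⟨h1, (integral_mono h1 ((hB s).1.norm.add (integrable_const ‖m‖))
      fun ω => norm_sub_le _ _).trans ?_⟩
    simp only [Pi.add_apply]
    rw [integral_add (hB s).1.norm (integrable_const ‖m‖)]
    simpa using (hB s).2
  have hprod := D.integrable_prod (f := fun x => ‖x - m‖) (by fun_prop)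
    (fun x => norm_nonneg _) hXm
  set J : Ω → ℝ := fun ω => ∫ r in a..b, (M0 + 2 * (M1 * ‖X (projIcc a b h r) ω - m‖)) with hJ
  have hpath : ∀ᵐ ω ∂P, IntervalIntegrable
      (fun r => M0 + 2 * (M1 * ‖X (projIcc a b h r) ω - m‖)) volume a b := by
    filter_upwards [hprod.prod_left_ae] with ω hω
    rw [intervalIntegrable_iff_integrableOn_Ioc_of_le h]
    exact (integrable_const _).add ((hω.const_mul _).const_mul _)
  have hJi : Integrable J P := by
    have h2 : Integrable (fun p : ℝ × Ω => M0 + 2 * (M1 * ‖X (projIcc a b h p.1) p.2 - m‖))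
        ((volume.restrict (Ioc a b)).prod P) :=
      (integrable_const _).add ((hprod.const_mul _).const_mul _)
    have := h2.integral_prod_right
    refine this.congr (Eventually.of_forall fun ω => ?_)
    simp only [hJ, intervalIntegral.integral_of_le h]
  have hrate : ∀ ω, ∀ r ∈ Icc a b,
      ‖quadRate h X σ β m r ω‖ ≤ M0 + 2 * (M1 * ‖X (projIcc a b h r) ω - m‖) := by
    intro ω r hr
    have h1 := D.abs_σ_le r hr ω
    have h2 := D.norm_β_le r hr ω
    have h3 := abs_real_inner_le_norm (X (projIcc a b h r) ω - m) (β r ω)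
    have h4 : ‖X (projIcc a b h r) ω - m‖ * ‖β r ω‖ ≤ ‖X (projIcc a b h r) ω - m‖ * M1 :=
      mul_le_mul_of_nonneg_left h2 (norm_nonneg _)
    rw [quadRate, Real.norm_eq_abs]
    refine (abs_add_le _ _).trans ?_
    rw [abs_mul, abs_two]
    linarith
  have hI : ∀ s : Icc a b, ∀ᵐ ω ∂P, |∫ r in a..s, quadRate h X σ β m r ω| ≤ J ω := by
    intro s
    filter_upwards [hpath] with ω hω
    have h1 := intervalIntegral.norm_integral_le_of_norm_le (μ := volume) s.2.1
      (f := fun r => quadRate h X σ β m r ω) (Eventually.of_forall fun r (hr : r ∈ Ioc a s.1) =>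
        hrate ω r ⟨hr.1.le, hr.2.trans s.2.2⟩)
      (hω.mono_set (by rw [uIcc_of_le h, uIcc_of_le s.2.1]; exact Icc_subset_Icc_right s.2.2))
    refine h1.trans ?_
    refine intervalIntegral.integral_mono_interval le_rfl s.2.1 s.2.2 ?_ hω
    filter_upwards [ae_restrict_mem measurableSet_Ioc] with r hr
    exact (norm_nonneg _).trans (hrate ω r ⟨hr.1.le, hr.2⟩)
  set M : Icc a b → Ω → ℝ := fun s ω => ‖X s ω - m‖ ^ 2 - ∫ r in a..s, quadRate h X σ β m r ω
    with hM
  have hMm : Martingale M ℱ P := D.martingale m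
  have hsq : ∀ s, ∀ᵐ ω ∂P, ‖X s ω - m‖ ^ 2 ≤ M s ω + J ω := by
    intro s
    filter_upwards [hI s] with ω hω
    have := (abs_le.1 hω).2
    simp only [hM]; linarith
  have hsqi : ∀ s, Integrable (fun ω => ‖X s ω - m‖ ^ 2) P := by
    intro s
    refine ((hMm.integrable s).add hJi).mono'
      (((D.measurable_apply s).sub_const m).norm.pow_const 2).aestronglyMeasurable ?_
    filter_upwards [hsq s] with ω hω
    rwa [Real.norm_of_nonneg (by positivity)]
  refine ⟨∫ ω, M ⟨b, hb⟩ ω ∂P + ∫ ω, J ω ∂P, fun s => ⟨hsqi s, ?_⟩⟩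
  refine (integral_mono_ae (hsqi s) ((hMm.integrable s).add hJi) (hsq s)).trans ?_
  simp only [Pi.add_apply]
  rw [integral_add (hMm.integrable s) hJi]
  have := hMm.setIntegral_eq (i := s) (j := ⟨b, hb⟩) s.2.2 MeasurableSet.univ
  simp only [setIntegral_univ] at this
  rw [this]

theorem integrable_sq (D : QuadDyn h ℱ P X σ β M0 M1) (s : Icc a b) (m : St d) :
    Integrable (fun ω => ‖X s ω - m‖ ^ 2) P :=
  let ⟨_, hB⟩ := D.exists_integral_sq_le m
  (hB s).1

theorem integrable_prod_sq (D : QuadDyn h ℱ P X σ β M0 M1) (s s' : Icc a b) (A : Set Ω)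
    (m : St d) :
    Integrable (fun p : ℝ × Ω => ‖X (projIcc a b h p.1) p.2 - m‖ ^ 2)
      ((volume.restrict (Ioc (s : ℝ) s')).prod (P.restrict A)) := by
  obtain ⟨B, hB⟩ := D.exists_integral_sq_le m
  have h1 := D.integrable_prod (f := fun x => ‖x - m‖ ^ 2) (by fun_prop)
    (fun x => by positivity) hB
  refine h1.mono_measure ?_
  refine Measure.prod_mono ?_ Measure.restrict_le_self
  exact Measure.restrict_mono (Ioc_subset_Ioc s.2.1 s'.2.2) le_rfl

/-- The increment of the second moment about `m` is controlled by an upper bound of the rate. -/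
theorem setIntegral_sq_le (D : QuadDyn h ℱ P X σ β M0 M1) {s s' : Icc a b} (hs : s ≤ s')
    {A : Set Ω} (hA : MeasurableSet[ℱ s] A) {m z : St d} {c0 c1 : ℝ}
    (hq : ∀ᵐ ω ∂P, ω ∈ A → ∀ r ∈ Ioo (s : ℝ) s',
      quadRate h X σ β m r ω ≤ c0 + c1 * ‖X (projIcc a b h r) ω - z‖ ^ 2) :
    ∫ ω in A, ‖X s' ω - m‖ ^ 2 ∂P ≤ ∫ ω in A, ‖X s ω - m‖ ^ 2 ∂P + c0 * (s' - s) * P.real A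
      + c1 * ∫ ω in A, (∫ r in (s : ℝ)..s', ‖X (projIcc a b h r) ω - z‖ ^ 2) ∂P := by
  have hs' : (s : ℝ) ≤ s' := hs
  set M : Icc a b → Ω → ℝ := fun s ω => ‖X s ω - m‖ ^ 2 - ∫ r in a..s, quadRate h X σ β m r ω
    with hM
  have hMm : Martingale M ℱ P := D.martingale m
  have hprod := D.integrable_prod_sq s s' A z
  have hJi : IntegrableOn (fun ω => ∫ r in (s : ℝ)..s', ‖X (projIcc a b h r) ω - z‖ ^ 2) A P := by
    refine hprod.integral_prod_right.congr (Eventually.of_forall fun ω => ?_)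
    simp only [intervalIntegral.integral_of_le hs']
  have hA' : MeasurableSet A := ℱ.le s A hA
  have hae : ∀ᵐ ω ∂(P.restrict A), ‖X s' ω - m‖ ^ 2 ≤ ‖X s ω - m‖ ^ 2 + (M s' ω - M s ω)
      + (c0 * (s' - s) + c1 * ∫ r in (s : ℝ)..s', ‖X (projIcc a b h r) ω - z‖ ^ 2) := by
    filter_upwards [ae_restrict_of_ae hq, ae_restrict_mem hA',
      ae_restrict_of_ae (D.intervalIntegrable_sub m), hprod.prod_left_ae] with ω h1 h2 h3 h4
    have h4' : IntervalIntegrable (fun r => ‖X (projIcc a b h r) ω - z‖ ^ 2) volume s s' := by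
      rw [intervalIntegrable_iff_integrableOn_Ioc_of_le hs']; exact h4
    have e1 := intervalIntegral.integral_add_adjacent_intervals (h3 ⟨a, le_rfl, h⟩ s) (h3 s s')
    have e2 := intervalIntegral.integral_mono_on_of_le_Ioo (μ := volume) hs' (h3 s s')
      ((intervalIntegrable_const (c := c0)).add (h4'.const_mul c1)) (h1 h2)
    rw [intervalIntegral.integral_add intervalIntegrable_const (h4'.const_mul c1),
      intervalIntegral.integral_const, intervalIntegral.integral_const_mul, smul_eq_mul] at e2
    simp only [hM]
    linarith
  have i1 := (D.integrable_sq s m).integrableOn (s := A)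
  have i2 : IntegrableOn (fun ω => M s' ω - M s ω) A P :=
    ((hMm.integrable s').sub (hMm.integrable s)).integrableOn
  have i3 : IntegrableOn (fun ω => c0 * ((s' : ℝ) - s) +
      c1 * ∫ r in (s : ℝ)..s', ‖X (projIcc a b h r) ω - z‖ ^ 2) A P :=
    (integrable_const _).add (hJi.const_mul c1)
  refine (integral_mono_ae (D.integrable_sq s' m).integrableOn ((i1.add i2).add i3) hae).trans ?_
  simp only [Pi.add_apply]
  rw [integral_add (by exact i1.add i2) i3, integral_add i1 i2,
    integral_sub (hMm.integrable s').integrableOn (hMm.integrable s).integrableOn,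
    integral_add (integrable_const _) (hJi.const_mul c1), integral_const_mul, integral_const_mul,
    hMm.setIntegral_eq hs hA, setIntegral_const]
  simp only [smul_eq_mul]
  linarith

/-- A process that starts near `z` stays near `z` in mean square. The parameter `H` bounds the
length of the time interval; it weights Young's inequality so that the term in `‖X - z‖²` can be
absorbed. -/
theorem setIntegral_sq_dist_le (D : QuadDyn h ℱ P X σ β M0 M1) {H : ℝ} (hH : 0 < H)
    (hbH : b - a ≤ H) {s s' : Icc a b} (hs : s ≤ s') {A : Set Ω} (hA : MeasurableSet[ℱ s] A)
    {z : St d} {δ : ℝ} (hδ : ∫ ω in A, ‖X s ω - z‖ ^ 2 ∂P ≤ δ * P.real A) :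
    ∫ ω in A, (∫ r in (s : ℝ)..s', ‖X (projIcc a b h r) ω - z‖ ^ 2) ∂P ≤
        2 * (s' - s) * (δ + (M0 + 2 * H * M1 ^ 2) * (s' - s)) * P.real A ∧
      ∫ ω in A, ‖X s' ω - z‖ ^ 2 ∂P ≤
        2 * (δ + (M0 + 2 * H * M1 ^ 2) * (s' - s)) * P.real A := by
  have hs' : (s : ℝ) ≤ s' := hs
  have hA' : MeasurableSet A := ℱ.le s A hA
  set C := M0 + 2 * H * M1 ^ 2 with hC
  have hne : Nonempty Ω := nonempty_of_isProbabilityMeasure P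
  obtain ⟨ω₀⟩ := hne
  have hM0 : 0 ≤ M0 := (abs_nonneg _).trans (D.abs_σ_le a ⟨le_rfl, h⟩ ω₀)
  have hC0 : 0 ≤ C := by positivity
  set I : ℝ → ℝ := fun t => ∫ ω in A, (∫ r in (s : ℝ)..t, ‖X (projIcc a b h r) ω - z‖ ^ 2) ∂P
    with hI
  have hrate : ∀ ω, ∀ r ∈ Icc a b, quadRate h X σ β z r ω ≤
      C + 1 / (2 * H) * ‖X (projIcc a b h r) ω - z‖ ^ 2 := by
    intro ω r hr
    have h1 := (le_abs_self _).trans (D.abs_σ_le r hr ω)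
    have h2 := D.norm_β_le r hr ω
    have h3 := real_inner_le_norm (X (projIcc a b h r) ω - z) (β r ω)
    set x := ‖X (projIcc a b h r) ω - z‖
    have h4 : x * ‖β r ω‖ ≤ x * M1 := mul_le_mul_of_nonneg_left h2 (norm_nonneg _)
    have h5 : 2 * (x * M1) ≤ 2 * H * M1 ^ 2 + 1 / (2 * H) * x ^ 2 := by
      have : 2 * H * M1 ^ 2 + 1 / (2 * H) * x ^ 2 - 2 * (x * M1) =
          1 / (2 * H) * (x - 2 * H * M1) ^ 2 := by field_simp; ring
      have : 0 ≤ 1 / (2 * H) * (x - 2 * H * M1) ^ 2 := by positivity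
      linarith
    rw [quadRate, hC]
    linarith
  have hinc : ∀ t : Icc a b, s ≤ t → ∫ ω in A, ‖X t ω - z‖ ^ 2 ∂P ≤
      (δ + C * (t - s)) * P.real A + 1 / (2 * H) * I t := by
    intro t hst
    have := D.setIntegral_sq_le hst hA (m := z) (z := z) (c0 := C) (c1 := 1 / (2 * H))
      (Eventually.of_forall fun ω _ r hr => hrate ω r ⟨s.2.1.trans hr.1.le, hr.2.le.trans t.2.2⟩)
    refine this.trans ?_
    simp only [hI]
    linarith
  have hprod := D.integrable_prod_sq s s' A z
  have hswap : I s' = ∫ r in (s : ℝ)..s', ∫ ω in A, ‖X (projIcc a b h r) ω - z‖ ^ 2 ∂P := by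
    simp only [hI, intervalIntegral.integral_of_le hs']
    exact (integral_integral_swap (f := fun r ω => ‖X (projIcc a b h r) ω - z‖ ^ 2) hprod).symm
  have hImono : ∀ t ∈ Icc (s : ℝ) s', I t ≤ I s' := by
    intro t ht
    have hpr := hprod.prod_left_ae
    have hint : ∀ t ∈ Icc (s : ℝ) s', IntegrableOn
        (fun ω => ∫ r in (s : ℝ)..t, ‖X (projIcc a b h r) ω - z‖ ^ 2) A P := by
      intro t ht
      have := D.integrable_prod_sq s ⟨t, s.2.1.trans ht.1, ht.2.trans s'.2.2⟩ A z
      refine this.integral_prod_right.congr (Eventually.of_forall fun ω => ?_)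
      simp only [intervalIntegral.integral_of_le ht.1]
    refine integral_mono_ae (hint t ht) (hint s' ⟨hs', le_rfl⟩) ?_
    filter_upwards [hpr] with ω hω
    refine intervalIntegral.integral_mono_interval le_rfl ht.1 ht.2
      (Eventually.of_forall fun r => by positivity) ?_
    rw [intervalIntegrable_iff_integrableOn_Ioc_of_le hs']; exact hω
  have hPA : 0 ≤ P.real A := measureReal_nonneg
  have hI0 : 0 ≤ I s' := by
    rw [hswap]
    exact intervalIntegral.integral_nonneg hs' fun r _ => integral_nonneg fun ω => by positivity
  have hIle : I s' ≤ ((s' : ℝ) - s) * ((δ + C * (s' - s)) * P.real A + 1 / (2 * H) * I s') := by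
    have hpt : ∀ r ∈ Icc (s : ℝ) s', ∫ ω in A, ‖X (projIcc a b h r) ω - z‖ ^ 2 ∂P ≤
        (δ + C * (s' - s)) * P.real A + 1 / (2 * H) * I s' := by
      intro r hr
      have hr' : r ∈ Icc a b := ⟨s.2.1.trans hr.1, hr.2.trans s'.2.2⟩
      rw [projIcc_of_mem h hr']
      have h1 := hinc ⟨r, hr'⟩ hr.1
      have h2 : 1 / (2 * H) * I r ≤ 1 / (2 * H) * I s' :=
        mul_le_mul_of_nonneg_left (hImono r hr) (by positivity)
      have h3 : (δ + C * (r - s)) * P.real A ≤ (δ + C * (s' - s)) * P.real A := by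
        have := mul_le_mul_of_nonneg_left hr.2 hC0
        exact mul_le_mul_of_nonneg_right (by linarith) hPA
      simp only at h1
      linarith
    conv_lhs => rw [hswap]
    have := intervalIntegral.integral_mono_on (μ := volume) hs'
      (f := fun r => ∫ ω in A, ‖X (projIcc a b h r) ω - z‖ ^ 2 ∂P)
      (g := fun _ => (δ + C * (s' - s)) * P.real A + 1 / (2 * H) * I s') ?_
      intervalIntegrable_const hpt
    · rwa [intervalIntegral.integral_const, smul_eq_mul] at this
    · rw [intervalIntegrable_iff_integrableOn_Ioc_of_le hs']
      exact hprod.integral_prod_left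
  have hh : ((s' : ℝ) - s) * (1 / (2 * H)) ≤ 1 / 2 := by
    rw [mul_one_div, div_le_div_iff₀ (by positivity) (by positivity)]
    linarith [s.2.1, s'.2.2]
  have hfin : I s' ≤ 2 * (s' - s) * (δ + C * (s' - s)) * P.real A := by
    have : ((s' : ℝ) - s) * (1 / (2 * H)) * I s' ≤ 1 / 2 * I s' :=
      mul_le_mul_of_nonneg_right hh hI0
    nlinarith
  refine ⟨hfin, (hinc s' hs).trans ?_⟩
  have hE : 0 ≤ 1 / (2 * H) := by positivity
  -- `I s' / (2 H)` is at most `(δ + C (s' - s)) P(A)`: this is `hinc` fed back into `hIle`.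
  have h6 : 1 / (2 * H) * I s' ≤ (δ + C * (s' - s)) * P.real A := by
    have h7 : 0 ≤ (δ + C * (s' - s)) * P.real A := by
      have h8 : 0 ≤ ∫ ω in A, ‖X s ω - z‖ ^ 2 ∂P := integral_nonneg fun ω => by positivity
      have : 0 ≤ C * (s' - s) * P.real A :=
        mul_nonneg (mul_nonneg hC0 (sub_nonneg.2 hs')) hPA
      linarith
    calc 1 / (2 * H) * I s' ≤ 1 / (2 * H) * (2 * (s' - s) * (δ + C * (s' - s)) * P.real A) :=
          mul_le_mul_of_nonneg_left hfin hE
      _ = 2 * (((s' : ℝ) - s) * (1 / (2 * H))) * ((δ + C * (s' - s)) * P.real A) := by ring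
      _ ≤ 2 * (1 / 2) * ((δ + C * (s' - s)) * P.real A) :=
          mul_le_mul_of_nonneg_right (by linarith) h7
      _ = _ := by ring
  linarith

/-- The growth of the second moment about `m`, for a process that starts near `z`. -/
theorem setIntegral_sq_le_of_near (D : QuadDyn h ℱ P X σ β M0 M1) {H : ℝ} (hH : 0 < H)
    (hbH : b - a ≤ H) {s s' : Icc a b} (hs : s ≤ s') {A : Set Ω} (hA : MeasurableSet[ℱ s] A)
    {m z : St d} {δ : ℝ} (hδ : ∫ ω in A, ‖X s ω - z‖ ^ 2 ∂P ≤ δ * P.real A) {c0 c1 : ℝ}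
    (hc1 : 0 ≤ c1)
    (hq : ∀ᵐ ω ∂P, ω ∈ A → ∀ r ∈ Ioo (s : ℝ) s',
      quadRate h X σ β m r ω ≤ c0 + c1 * ‖X (projIcc a b h r) ω - z‖ ^ 2) :
    ∫ ω in A, ‖X s' ω - m‖ ^ 2 ∂P ≤ ∫ ω in A, ‖X s ω - m‖ ^ 2 ∂P
      + (s' - s) * (c0 + c1 * (2 * (δ + (M0 + 2 * H * M1 ^ 2) * (s' - s)))) * P.real A := by
  refine (D.setIntegral_sq_le hs hA hq).trans ?_
  have := mul_le_mul_of_nonneg_left (D.setIntegral_sq_dist_le hH hbH hs hA hδ).1 hc1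
  linarith

end QuadDyn

/-! ### Càdlàg paths, motions and guides -/

/-- Right-continuity makes a process with càdlàg paths jointly measurable in time and chance. -/
theorem Path.measurable_uncurry {Ω : Type*} [MeasurableSpace Ω] {a b : ℝ} (h : a ≤ b)
    {X : Ω → Path d a b} (hX : ∀ s, Measurable fun ω => X ω s) :
    Measurable fun p : Icc a b × Ω => X p.2 p.1 := by
  set ρ : ℕ → ℤ → Icc a b := fun n k => projIcc a b h ((k + 1) / (n + 1)) with hρ
  refine measurable_of_tendsto_metrizable (f := fun n (p : Icc a b × Ω) =>
    X p.2 (ρ n ⌊((n : ℝ) + 1) * p.1⌋)) (fun n => ?_) (tendsto_pi_nhds.2 fun p => ?_)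
  · have h1 : Measurable fun q : ℤ × Ω => X q.2 (ρ n q.1) :=
      measurable_from_prod_countable_right fun k => hX (ρ n k)
    refine h1.comp (Measurable.prodMk ?_ measurable_snd)
    exact Int.measurable_floor.comp ((measurable_subtype_coe.comp measurable_fst).const_mul _)
  · obtain ⟨s, ω⟩ := p
    have hup : ∀ n : ℕ, (s : ℝ) ≤ (⌊((n : ℝ) + 1) * s⌋ + 1) / (n + 1) := by
      intro n
      rw [le_div_iff₀ (by positivity)]
      linarith [Int.lt_floor_add_one (((n : ℝ) + 1) * s)]
    have hge : ∀ n : ℕ, s ≤ ρ n ⌊((n : ℝ) + 1) * s⌋ := by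
      intro n
      have := monotone_projIcc h (hup n)
      rwa [projIcc_val] at this
    refine ((X ω).2 s).1.tendsto.comp (tendsto_nhdsWithin_iff.2 ⟨?_, Eventually.of_forall hge⟩)
    have hlim : Tendsto (fun n : ℕ => ((⌊((n : ℝ) + 1) * s⌋ : ℝ) + 1) / (n + 1)) atTop
        (𝓝 (s : ℝ)) := by
      refine tendsto_of_tendsto_of_tendsto_of_le_of_le tendsto_const_nhds
        (h := fun n : ℕ => (s : ℝ) + 1 / ((n : ℝ) + 1)) ?_ hup (fun n => ?_)
      · simpa using (tendsto_const_nhds (x := (s : ℝ))).add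
          (tendsto_one_div_add_atTop_nhds_zero_nat (𝕜 := ℝ))
      · have hn : (0 : ℝ) < n + 1 := by positivity
        have := Int.floor_le (((n : ℝ) + 1) * s)
        rw [div_le_iff₀ hn]
        have e : ((s : ℝ) + 1 / ((n : ℝ) + 1)) * (n + 1) = (n + 1) * s + 1 := by
          field_simp
        linarith
    have := (continuous_projIcc (h := h)).continuousAt.tendsto.comp hlim
    rwa [projIcc_val] at this

/-- Càdlàg paths on a compact interval are bounded. -/
theorem Path.exists_norm_le {a b : ℝ} (x : Path d a b) : ∃ B, ∀ s, ‖x s‖ ≤ B := by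
  have key : ∃ B, ∀ s ∈ (univ : Set (Icc a b)), ‖x s‖ ≤ B := by
    refine isCompact_univ.induction_on (p := fun S => ∃ B, ∀ s ∈ S, ‖x s‖ ≤ B)
      ⟨0, by simp⟩ (fun S S' hS ⟨B, hB⟩ => ⟨B, fun s hs => hB s (hS hs)⟩)
      (fun S S' ⟨B, hB⟩ ⟨B', hB'⟩ => ⟨max B B', fun s hs => ?_⟩) (fun s _ => ?_)
    · rcases hs with hs | hs
      · exact (hB s hs).trans (le_max_left _ _)
      · exact (hB' s hs).trans (le_max_right _ _)
    · obtain ⟨hr, l, hl⟩ := x.2 s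
      have h1 : ∀ᶠ r in 𝓝[<] s, ‖x r‖ ≤ max (‖l‖ + 1) (‖x s‖ + 1) := by
        filter_upwards [hl.norm.eventually (gt_mem_nhds (lt_add_one ‖l‖))] with r hr
        exact hr.le.trans (le_max_left _ _)
      have h2 : ∀ᶠ r in 𝓝[≥] s, ‖x r‖ ≤ max (‖l‖ + 1) (‖x s‖ + 1) := by
        filter_upwards [hr.tendsto.norm.eventually (gt_mem_nhds (lt_add_one ‖x s‖))] with r hr
        exact hr.le.trans (le_max_right _ _)
      have h3 : ∀ᶠ r in 𝓝 s, ‖x r‖ ≤ max (‖l‖ + 1) (‖x s‖ + 1) := by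
        rw [← nhdsLT_sup_nhdsGE]
        exact eventually_sup.2 ⟨h1, h2⟩
      exact ⟨_, by rw [nhdsWithin_univ]; exact h3, _, fun r hr => hr⟩
  obtain ⟨B, hB⟩ := key
  exact ⟨B, fun s => hB s (mem_univ s)⟩

theorem _root_.MeasureTheory.IsStronglyProgressive.measurable_path {Ω A : Type*}
    [mΩ : MeasurableSpace Ω] [MetricSpace A] [MeasurableSpace A] [BorelSpace A] {a b : ℝ}
    (h : a ≤ b) {ℱ : Filtration (Icc a b) mΩ} {Y : Icc a b → Ω → A}
    (hY : IsStronglyProgressive ℱ Y) (ω : Ω) : Measurable fun s => Y s ω := by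
  have h1 := (hY ⟨b, h, le_rfl⟩).measurable
  have h2 : Measurable[_, Subtype.instMeasurableSpace.prod (ℱ ⟨b, h, le_rfl⟩)]
      fun s : Icc a b => ((⟨s, s.2.2⟩ : Iic (⟨b, h, le_rfl⟩ : Icc a b)), ω) := by
    refine @Measurable.prodMk _ _ _ _ (_) _ _ _ ?_ measurable_const
    exact measurable_id.subtype_mk
  exact h1.comp h2

theorem _root_.MeasureTheory.IsStronglyProgressive.measurable_uncurry {Ω A : Type*}
    [mΩ : MeasurableSpace Ω] [MetricSpace A] [MeasurableSpace A] [BorelSpace A] {a b : ℝ}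
    (h : a ≤ b) {ℱ : Filtration (Icc a b) mΩ} {Y : Icc a b → Ω → A}
    (hY : IsStronglyProgressive ℱ Y) : Measurable fun p : Icc a b × Ω => Y p.1 p.2 := by
  have h1 := (hY ⟨b, h, le_rfl⟩).measurable
  have h2 : Measurable[_, Subtype.instMeasurableSpace.prod (ℱ ⟨b, h, le_rfl⟩)]
      fun p : Icc a b × Ω => ((⟨p.1, p.1.2.2⟩ : Iic (⟨b, h, le_rfl⟩ : Icc a b)), p.2) := by
    refine @Measurable.prodMk _ _ _ _ (_) _ _ _ ?_ ?_
    · exact measurable_fst.subtype_mk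
    · exact measurable_snd.mono le_rfl (ℱ.le _)
  exact h1.comp h2

section Game

variable [MetricSpace U] [MeasurableSpace U] [MetricSpace V] [MeasurableSpace V]
  {L : Coefficients d U V} {T M0 M1 : ℝ} {K : ℝ≥0} {𝒟 : Set (St d → ℝ)}

attribute [instance] Motion.mΩ Motion.isProbability

section Motion

variable {t₀ : ℝ} {h : t₀ ≤ T} {x₀ : St d} {𝔲 : Strategy d U t₀ T} {𝔳 : Strategy d V t₀ T}

/-- The filtration of a realization. -/
abbrev Motion.filtration (m : Motion L 𝒟 h x₀ 𝔲 𝔳) :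
    Filtration (Icc t₀ T) (inferInstance : MeasurableSpace (m.Ω × 𝔲.Ω × 𝔳.Ω)) :=
  prodFiltration m.ℱ (prodFiltration 𝔲.ℱ 𝔳.ℱ)

/-- The drift of a realization along its controls. -/
noncomputable def Motion.drift (m : Motion L 𝒟 h x₀ 𝔲 𝔳) (r : ℝ)
    (ω : m.Ω × 𝔲.Ω × 𝔳.Ω) : St d :=
  L.drift (projIcc t₀ T h r) (m.X ω (projIcc t₀ T h r))
    (𝔲.control (m.X ω) (projIcc t₀ T h r) ω.2.1) (𝔳.control (m.X ω) (projIcc t₀ T h r) ω.2.2)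

/-- The spread of a realization along its controls. -/
noncomputable def Motion.spread (m : Motion L 𝒟 h x₀ 𝔲 𝔳) (r : ℝ)
    (ω : m.Ω × 𝔲.Ω × 𝔳.Ω) : ℝ :=
  L.spread (projIcc t₀ T h r) (m.X ω (projIcc t₀ T h r))
    (𝔲.control (m.X ω) (projIcc t₀ T h r) ω.2.1) (𝔳.control (m.X ω) (projIcc t₀ T h r) ω.2.2)

theorem Motion.measurable_eval (m : Motion L 𝒟 h x₀ 𝔲 𝔳) (s : Icc t₀ T) :
    Measurable fun ω => m.X ω s :=
  (m.adapted s).mono (m.filtration.le s) le_rfl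

variable [CompactSpace U] [BorelSpace U] [CompactSpace V] [BorelSpace V]

theorem Motion.quadDyn (hL : L.IsRegular T M0 M1 K) (h𝒟 : IsTestClass 𝒟) (ht₀ : 0 ≤ t₀)
    (m : Motion L 𝒟 h x₀ 𝔲 𝔳) :
    QuadDyn h m.filtration m.P (fun s ω => m.X ω s) m.spread m.drift M0 M1 := by
  have hmem : ∀ r : Icc t₀ T, (r : ℝ) ∈ Icc 0 T := fun r => ⟨ht₀.trans r.2.1, r.2.2⟩
  have hσ : ∀ r ω, |m.spread r ω| ≤ M0 := fun r ω => (hL.bounded _ (hmem _) _ _ _).2.1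
  have hβ : ∀ r ω, ‖m.drift r ω‖ ≤ M1 := fun r ω => (hL.bounded _ (hmem _) _ _ _).2.2
  have hproj : Measurable (projIcc t₀ T h) := continuous_projIcc.measurable
  have hpath : ∀ ω, Measurable fun r => ((⟨projIcc t₀ T h r, hmem _⟩ : Icc (0 : ℝ) T),
      m.X ω (projIcc t₀ T h r), 𝔲.control (m.X ω) (projIcc t₀ T h r) ω.2.1,
      𝔳.control (m.X ω) (projIcc t₀ T h r) ω.2.2) := by
    intro ω
    refine Measurable.prodMk ?_ (Measurable.prodMk ?_ (Measurable.prodMk ?_ ?_))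
    · exact (measurable_subtype_coe.comp hproj).subtype_mk
    · exact ((Path.measurable_uncurry h m.measurable_eval).comp
        (measurable_id.prodMk measurable_const)).comp hproj
    · exact ((𝔲.progressive (m.X ω)).measurable_path h ω.2.1).comp hproj
    · exact ((𝔳.progressive (m.X ω)).measurable_path h ω.2.2).comp hproj
  refine ⟨Path.measurable_uncurry h m.measurable_eval, fun r _ ω => hσ r ω, fun r _ ω => hβ r ω,
    fun c => Eventually.of_forall fun ω => ?_, fun c => ?_⟩
  · have hσm : Measurable fun r => m.spread r ω := hL.measurable_spread.comp (hpath ω)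
    have hβm : Measurable fun r => m.drift r ω := hL.measurable_drift.comp (hpath ω)
    have hXm : Measurable fun r => m.X ω (projIcc t₀ T h r) :=
      (measurable_fst.comp measurable_snd).comp (hpath ω)
    obtain ⟨B, hB⟩ := (m.X ω).exists_norm_le
    rw [intervalIntegrable_iff_integrableOn_Ioc_of_le h]
    refine Integrable.of_bound (C := M0 + 2 * ((B + ‖c‖) * M1)) ?_ (Eventually.of_forall fun r => ?_)
    · exact (hσm.add (((hXm.sub_const c).inner hβm).const_mul 2)).aestronglyMeasurable
    · have h1 := hσ r ω
      have h2 := hβ r ω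
      have h3 := abs_real_inner_le_norm (m.X ω (projIcc t₀ T h r) - c) (m.drift r ω)
      have h4 : ‖m.X ω (projIcc t₀ T h r) - c‖ ≤ B + ‖c‖ :=
        (norm_sub_le _ _).trans (by linarith [hB (projIcc t₀ T h r)])
      have h5 := mul_le_mul h4 h2 (norm_nonneg _) ((norm_nonneg _).trans h4)
      rw [quadRate, Real.norm_eq_abs]
      refine (abs_add_le _ _).trans ?_
      rw [abs_mul, abs_two]
      linarith
  · have := m.martingale _ (h𝒟.quadratic_mem c)
    have e : ∀ (s : Icc t₀ T) ω,
        ∫ r in t₀..s, quadRate h (fun s ω => m.X ω s) m.spread m.drift c r ω =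
        ∫ r in t₀..s, L.gen r (𝔲.control (m.X ω) (projIcc t₀ T h r) ω.2.1)
          (𝔳.control (m.X ω) (projIcc t₀ T h r) ω.2.2) (fun x => ‖x - c‖ ^ 2)
          (m.X ω (projIcc t₀ T h r)) := by
      intro s ω
      refine intervalIntegral.integral_congr fun r hr => ?_
      rw [uIcc_of_le s.2.1] at hr
      have hr' : r ∈ Icc t₀ T := ⟨hr.1, hr.2.trans s.2.2⟩
      have hr0 : r ∈ Icc 0 T := ⟨ht₀.trans hr.1, hr'.2⟩
      beta_reduce
      rw [L.gen_sq_dist (hL.bounded r hr0 _ _ _).1]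
      simp only [quadRate, Motion.spread, Motion.drift, projIcc_of_mem h hr']
    simp only [e]
    exact this

end Motion

section Stability

variable [BorelSpace U] {t θ : ℝ} {h : t ≤ θ}

/-- The drift of a guide, averaged over the generalized control. -/
noncomputable def StabilityData.drift (S : StabilityData d U V t θ) (h : t ≤ θ)
    (L : Coefficients d U V) (ξ : St d) (v : V) (r : ℝ) (ω : S.Ω) : St d :=
  ∫ w, L.drift (projIcc t θ h r) (S.Y ξ v (projIcc t θ h r) ω) w v
    ∂(S.μ ξ v (projIcc t θ h r) ω : Measure U)

/-- The spread of a guide, averaged over the generalized control. -/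
noncomputable def StabilityData.spread (S : StabilityData d U V t θ) (h : t ≤ θ)
    (L : Coefficients d U V) (ξ : St d) (v : V) (r : ℝ) (ω : S.Ω) : ℝ :=
  ∫ w, L.spread (projIcc t θ h r) (S.Y ξ v (projIcc t θ h r) ω) w v
    ∂(S.μ ξ v (projIcc t θ h r) ω : Measure U)

variable [CompactSpace U] [CompactSpace V] [BorelSpace V]

theorem Coefficients.IsRegular.integrable_drift (hL : L.IsRegular T M0 M1 K) {t : ℝ}
    (ht : t ∈ Icc 0 T) (x : St d) (v : V) (μ : Measure U) [IsFiniteMeasure μ] :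
    Integrable (fun w => L.drift t x w v) μ := by
  have hp : Measurable fun w : U => ((⟨t, ht⟩ : Icc (0 : ℝ) T), x, w, v) := by fun_prop
  exact Integrable.of_bound (hL.measurable_drift.comp hp).aestronglyMeasurable M1
    (Eventually.of_forall fun w => (hL.bounded t ht x w v).2.2)

theorem Coefficients.IsRegular.integrable_spread (hL : L.IsRegular T M0 M1 K) {t : ℝ}
    (ht : t ∈ Icc 0 T) (x : St d) (v : V) (μ : Measure U) [IsFiniteMeasure μ] :
    Integrable (fun w => L.spread t x w v) μ := by
  have hp : Measurable fun w : U => ((⟨t, ht⟩ : Icc (0 : ℝ) T), x, w, v) := by fun_prop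
  exact Integrable.of_bound (hL.measurable_spread.comp hp).aestronglyMeasurable M0
    (Eventually.of_forall fun w => (hL.bounded t ht x w v).2.1)

theorem StabilityData.IsAdmissible.quadDyn (hL : L.IsRegular T M0 M1 K) (h𝒟 : IsTestClass 𝒟)
    (ht : 0 ≤ t) (hθ : θ ≤ T) {S : StabilityData d U V t θ} {c : ℝ → St d → ℝ}
    (hS : S.IsAdmissible h L 𝒟 c) (ξ : St d) (v : V) :
    QuadDyn h S.ℱ (S.P ξ v) (S.Y ξ v) (S.spread h L ξ v) (S.drift h L ξ v) M0 M1 := by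
  have hmem : ∀ r : Icc t θ, (r : ℝ) ∈ Icc 0 T := fun r => ⟨ht.trans r.2.1, r.2.2.trans hθ⟩
  have hrate : ∀ (m : St d) (ω : S.Ω), ∀ r ∈ Icc t θ,
      quadRate h (S.Y ξ v) (S.spread h L ξ v) (S.drift h L ξ v) m r ω
        = S.rate h L (fun z => ‖z - m‖ ^ 2) ξ v ω r := by
    intro m ω r hr
    have hr' := hmem ⟨r, hr⟩
    simp only [quadRate, StabilityData.rate, StabilityData.spread, StabilityData.drift,
      projIcc_of_mem h hr]
    have e : ∀ w, L.gen r w v (fun z => ‖z - m‖ ^ 2) (S.Y ξ v ⟨r, hr⟩ ω) =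
        L.spread r (S.Y ξ v ⟨r, hr⟩ ω) w v
          + 2 * inner ℝ (S.Y ξ v ⟨r, hr⟩ ω - m) (L.drift r (S.Y ξ v ⟨r, hr⟩ ω) w v) :=
      fun w => L.gen_sq_dist (hL.bounded r hr' _ _ _).1 m
    simp_rw [e]
    have hd := hL.integrable_drift hr' (S.Y ξ v ⟨r, hr⟩ ω) v (S.μ ξ v ⟨r, hr⟩ ω : Measure U)
    rw [integral_add (hL.integrable_spread hr' _ v _) ((hd.const_inner _).const_mul 2),
      integral_const_mul, integral_inner hd]
  refine ⟨(hS.progressive_Y ξ v).measurable_uncurry h, fun r _ ω => ?_, fun r _ ω => ?_,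
    fun m => ?_, fun m => ?_⟩
  · have := norm_integral_le_of_norm_le_const (μ := (S.μ ξ v (projIcc t θ h r) ω : Measure U))
      (f := fun w => L.spread (projIcc t θ h r) (S.Y ξ v (projIcc t θ h r) ω) w v) (C := M0)
      (Eventually.of_forall fun w => (hL.bounded _ (hmem (projIcc t θ h r)) _ w v).2.1)
    rwa [probReal_univ, mul_one] at this
  · have := norm_integral_le_of_norm_le_const (μ := (S.μ ξ v (projIcc t θ h r) ω : Measure U))
      (f := fun w => L.drift (projIcc t θ h r) (S.Y ξ v (projIcc t θ h r) ω) w v) (C := M1)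
      (Eventually.of_forall fun w => (hL.bounded _ (hmem (projIcc t θ h r)) _ w v).2.2)
    rwa [probReal_univ, mul_one] at this
  · filter_upwards [hS.integrable_rate _ (h𝒟.quadratic_mem m) ξ v] with ω hω
    refine hω.congr fun r hr => ?_
    rw [uIoc_of_le h] at hr
    exact (hrate m ω r ⟨hr.1.le, hr.2⟩).symm
  · have := hS.martingale _ (h𝒟.quadratic_mem m) ξ v
    have e : ∀ (s : Icc t θ) ω, ∫ r in t..s,
        quadRate h (S.Y ξ v) (S.spread h L ξ v) (S.drift h L ξ v) m r ω =
        ∫ r in t..s, S.rate h L (fun z => ‖z - m‖ ^ 2) ξ v ω r := by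
      intro s ω
      refine intervalIntegral.integral_congr fun r hr => ?_
      rw [uIcc_of_le s.2.1] at hr
      exact hrate m ω r ⟨hr.1, hr.2.trans s.2.2⟩
    simp only [e]
    exact this

end Stability

end Game

/-! ### Inf-convolutions -/

/-- The inf-convolution of `c` with `p ‖·‖²`. -/
noncomputable def infConv (p : ℝ) (c : St d → ℝ) (x : St d) : ℝ :=
  ⨅ y, (c y + p * ‖x - y‖ ^ 2)

section InfConv

variable {g c : St d → ℝ} {R : ℝ≥0} {B p : ℝ}

theorem sub_le_add_mul_sq (hg : LipschitzWith R g) (hc : ∀ y, g y - B ≤ c y) (hp : 0 < p)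
    (x y : St d) : g x - (B + R ^ 2 / (4 * p)) ≤ c y + p * ‖x - y‖ ^ 2 := by
  have h1 : g x - g y ≤ R * ‖x - y‖ := by
    have := hg.dist_le_mul x y
    rw [dist_eq_norm, dist_eq_norm] at this
    exact (le_abs_self _).trans this
  have h2 : R * ‖x - y‖ ≤ p * ‖x - y‖ ^ 2 + R ^ 2 / (4 * p) := by
    have e : p * ‖x - y‖ ^ 2 + R ^ 2 / (4 * p) - R * ‖x - y‖
        = p * (‖x - y‖ - R / (2 * p)) ^ 2 := by
      field_simp; ring
    have : 0 ≤ p * (‖x - y‖ - R / (2 * p)) ^ 2 := by positivity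
    linarith
  linarith [hc y]

theorem bddBelow_infConv (hg : LipschitzWith R g) (hc : ∀ y, g y - B ≤ c y) (hp : 0 < p)
    (x : St d) : BddBelow (range fun y => c y + p * ‖x - y‖ ^ 2) :=
  ⟨_, by rintro _ ⟨y, rfl⟩; exact sub_le_add_mul_sq hg hc hp x y⟩

theorem infConv_le (hg : LipschitzWith R g) (hc : ∀ y, g y - B ≤ c y) (hp : 0 < p)
    (x y : St d) : infConv p c x ≤ c y + p * ‖x - y‖ ^ 2 :=
  ciInf_le (bddBelow_infConv hg hc hp x) y

theorem le_infConv (hg : LipschitzWith R g) (hc : ∀ y, g y - B ≤ c y) (hp : 0 < p)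
    (x : St d) : g x - (B + R ^ 2 / (4 * p)) ≤ infConv p c x :=
  le_ciInf fun y => sub_le_add_mul_sq hg hc hp x y

theorem exists_lt_infConv_add (p : ℝ) (c : St d → ℝ) (x : St d) {η : ℝ} (hη : 0 < η) :
    ∃ y, c y + p * ‖x - y‖ ^ 2 < infConv p c x + η :=
  exists_lt_of_ciInf_lt (lt_add_of_pos_right _ hη)

/-- Up to the function `p ‖·‖²` the inf-convolution is an infimum of affine functions, hence
concave; this makes it continuous although `c` is arbitrary. -/
theorem continuous_infConv (hg : LipschitzWith R g) (hc : ∀ y, g y - B ≤ c y) (hp : 0 < p) :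
    Continuous (infConv p c) := by
  have hconc : ConcaveOn ℝ univ fun x : St d => infConv p c x - p * ‖x‖ ^ 2 := by
    refine ⟨convex_univ, fun x₁ _ x₂ _ a b ha hb hab => ?_⟩
    have key : ∀ x y : St d, c y + p * ‖x - y‖ ^ 2 - p * ‖x‖ ^ 2
        = c y - 2 * p * inner ℝ x y + p * ‖y‖ ^ 2 := by
      intro x y
      rw [norm_sub_sq_real]; ring
    have h1 : a • (infConv p c x₁ - p * ‖x₁‖ ^ 2) + b • (infConv p c x₂ - p * ‖x₂‖ ^ 2)
        + p * ‖a • x₁ + b • x₂‖ ^ 2 ≤ infConv p c (a • x₁ + b • x₂) := by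
      refine le_ciInf fun y => ?_
      have e1 := key x₁ y
      have e2 := key x₂ y
      have e3 := key (a • x₁ + b • x₂) y
      have i1 := infConv_le hg hc hp x₁ y
      have i2 := infConv_le hg hc hp x₂ y
      have j1 := mul_le_mul_of_nonneg_left
        (show infConv p c x₁ - p * ‖x₁‖ ^ 2 ≤ c y - 2 * p * inner ℝ x₁ y + p * ‖y‖ ^ 2 by
          linarith) ha
      have j2 := mul_le_mul_of_nonneg_left
        (show infConv p c x₂ - p * ‖x₂‖ ^ 2 ≤ c y - 2 * p * inner ℝ x₂ y + p * ‖y‖ ^ 2 by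
          linarith) hb
      have e4 : a * (c y - 2 * p * inner ℝ x₁ y + p * ‖y‖ ^ 2)
          + b * (c y - 2 * p * inner ℝ x₂ y + p * ‖y‖ ^ 2)
          = c y - 2 * p * inner ℝ (a • x₁ + b • x₂) y + p * ‖y‖ ^ 2 := by
        rw [inner_add_left, inner_smul_left, inner_smul_left]
        simp only [conj_trivial]
        linear_combination (c y + p * ‖y‖ ^ 2) * hab
      simp only [smul_eq_mul]
      linarith
    simp only [smul_eq_mul] at h1 ⊢
    linarith
  have h2 : Continuous fun x : St d => infConv p c x - p * ‖x‖ ^ 2 :=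
    hconc.locallyLipschitz.continuous
  have h3 : Continuous fun x : St d => (infConv p c x - p * ‖x‖ ^ 2) + p * ‖x‖ ^ 2 :=
    h2.add (by fun_prop)
  simpa using h3

theorem QuadDyn.integrable_infConv {Ω : Type*} [mΩ : MeasurableSpace Ω] {a b : ℝ} {h : a ≤ b}
    {ℱ : Filtration (Icc a b) mΩ} {P : Measure Ω} [IsProbabilityMeasure P]
    {X : Icc a b → Ω → St d} {σ : ℝ → Ω → ℝ} {β : ℝ → Ω → St d} {M0 M1 : ℝ}
    (D : QuadDyn h ℱ P X σ β M0 M1) (hg : LipschitzWith R g) (hc : ∀ y, g y - B ≤ c y)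
    (hp : 0 < p) (s : Icc a b) : Integrable (fun ω => infConv p c (X s ω)) P := by
  have hsq : Integrable (fun ω => ‖X s ω‖ ^ 2) P := by simpa using D.integrable_sq s 0
  have hi : Integrable (fun ω => (|c 0| + |g 0| + |B + R ^ 2 / (4 * p)| + R)
      + (p + R) * ‖X s ω‖ ^ 2) P := (integrable_const _).add (hsq.const_mul _)
  refine hi.mono' ((continuous_infConv hg hc hp).measurable.comp
    (D.measurable_apply s)).aestronglyMeasurable (Eventually.of_forall fun ω => ?_)
  set x := X s ω
  have h1 := infConv_le hg hc hp x 0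
  have h2 := le_infConv hg hc hp x
  have h3 : |g x - g 0| ≤ R * ‖x‖ := by
    have := hg.dist_le_mul x 0
    rwa [Real.dist_eq, dist_zero_right] at this
  have h4 : R * ‖x‖ ≤ R * (1 + ‖x‖ ^ 2) := by
    refine mul_le_mul_of_nonneg_left ?_ R.2
    nlinarith [sq_nonneg (‖x‖ - 1), norm_nonneg x]
  rw [sub_zero] at h1
  rw [Real.norm_eq_abs, abs_le]
  have h5 := abs_le.1 h3
  have : 0 ≤ R * (1 + ‖x‖ ^ 2) := by positivity
  have : 0 ≤ p * ‖x‖ ^ 2 := by positivity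
  constructor
  · linarith [neg_abs_le (g 0), le_abs_self (B + R ^ 2 / (4 * p)), abs_nonneg (c 0)]
  · linarith [le_abs_self (c 0), abs_nonneg (g 0), abs_nonneg (B + R ^ 2 / (4 * p))]

end InfConv

/-! ### Random vectors and countable partitions -/

theorem integral_sq_dist_eq {Ω : Type*} [MeasurableSpace Ω] {P : Measure Ω}
    [IsProbabilityMeasure P] {Y : Ω → St d} (hY : Integrable Y P)
    (hY2 : ∀ x, Integrable (fun ω => ‖Y ω - x‖ ^ 2) P) (x : St d) :
    ∫ ω, ‖Y ω - x‖ ^ 2 ∂P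
      = ‖x - ∫ ω, Y ω ∂P‖ ^ 2 + ∫ ω, ‖Y ω - ∫ ω, Y ω ∂P‖ ^ 2 ∂P := by
  set m := ∫ ω, Y ω ∂P with hm
  have h1 : ∀ ω, ‖Y ω - x‖ ^ 2 = ‖Y ω - m‖ ^ 2 + (2 * inner ℝ (m - x) (Y ω - m) + ‖x - m‖ ^ 2) := by
    intro ω
    rw [show Y ω - x = (Y ω - m) + (m - x) by abel, norm_add_sq_real, real_inner_comm,
      norm_sub_rev m x]
    ring
  have h2 : Integrable (fun ω => Y ω - m) P := hY.sub (integrable_const m)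
  have h3 : Integrable (fun ω => 2 * inner ℝ (m - x) (Y ω - m)) P :=
    (h2.const_inner _).const_mul 2
  have h4 : Integrable (fun ω => 2 * inner ℝ (m - x) (Y ω - m) + ‖x - m‖ ^ 2) P :=
    h3.add (integrable_const _)
  simp_rw [h1]
  rw [integral_add (hY2 m) h4, integral_add h3 (integrable_const _),
    integral_const_mul, integral_inner h2, integral_sub hY (integrable_const m)]
  simp [← hm]
  ring

/-- An integral is nonpositive if it is so over each piece of a countable partition. -/
theorem integral_nonpos_of_fiber {Ω : Type*} [MeasurableSpace Ω] {P : Measure Ω} {f : Ω → ℝ}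
    (hf : Integrable f P) {N : Ω → ℕ} (hN : Measurable N)
    (h : ∀ n, ∫ ω in N ⁻¹' {n}, f ω ∂P ≤ 0) : ∫ ω, f ω ∂P ≤ 0 := by
  have hU : ⋃ n, N ⁻¹' {n} = univ := by
    ext ω; simp
  have h1 := integral_iUnion (μ := P) (f := f) (s := fun n => N ⁻¹' {n})
    (fun n => hN (measurableSet_singleton n))
    (fun i j hij => Disjoint.preimage _ (by simpa using hij)) hf.integrableOn
  rw [hU, setIntegral_univ] at h1
  rw [h1]
  exact tsum_nonpos h

/-- Every neighbourhood assignment on `ℝ^d` has a measurable selection with countably many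
values. -/
theorem exists_measurable_nat_cover {O : St d → Set (St d)} (hO : ∀ z, O z ∈ 𝓝 z)
    (hm : ∀ z, MeasurableSet (O z)) :
    ∃ (z : ℕ → St d) (N : St d → ℕ), Measurable N ∧ ∀ x, x ∈ O (z (N x)) := by
  classical
  obtain ⟨s, hs, hsU⟩ := TopologicalSpace.countable_cover_nhds hO
  have hne : s.Nonempty := by
    by_contra hs0
    rw [not_nonempty_iff_eq_empty] at hs0
    subst hs0
    have h0 : (0 : St d) ∈ ⋃ x ∈ (∅ : Set (St d)), O x := hsU ▸ mem_univ _
    simp at h0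
  obtain ⟨z, hz⟩ := hs.exists_eq_range hne
  have hex : ∀ x, ∃ n, x ∈ O (z n) := by
    intro x
    have : x ∈ ⋃ y ∈ s, O y := by rw [hsU]; trivial
    rw [mem_iUnion₂] at this
    obtain ⟨y, hy, hx⟩ := this
    rw [hz] at hy
    obtain ⟨n, rfl⟩ := hy
    exact ⟨n, hx⟩
  exact ⟨z, fun x => Nat.find (hex x), measurable_find _ fun n => hm (z n),
    fun x => Nat.find_spec (hex x)⟩

/-! ### Stable functions are bounded below -/

section Stable

variable [MetricSpace U] [CompactSpace U] [MeasurableSpace U] [BorelSpace U]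
  [MetricSpace V] [CompactSpace V] [Nonempty V] [MeasurableSpace V] [BorelSpace V]
  {L : Coefficients d U V} {T M0 M1 : ℝ} {K R : ℝ≥0} {𝒟 : Set (St d → ℝ)}
  {g : St d → ℝ} {c : ℝ → St d → ℝ}

theorem IsUStable.exists_sub_le (hL : L.IsRegular T M0 M1 K) (h𝒟 : IsTestClass 𝒟)
    (hg : LipschitzWith R g) (hc : IsUStable T L 𝒟 g c) (hT : 0 ≤ T) :
    ∃ B, ∀ t ∈ Icc 0 T, ∀ ξ, g ξ - B ≤ c t ξ := by
  set C := M0 + 2 * (T + 1) * M1 ^ 2 with hC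
  refine ⟨R * (1 + 2 * (|C| * T)), fun t ht ξ => ?_⟩
  have hB : 0 ≤ R * (1 + 2 * (|C| * T)) := by positivity
  rcases ht.2.eq_or_lt with rfl | htT
  · rw [hc.1]; linarith
  obtain ⟨S, hS⟩ := hc.2 t T ht.1 htT le_rfl
  obtain ⟨v⟩ := ‹Nonempty V›
  have := hS.isProbability ξ v
  have D := hS.quadDyn hL h𝒟 ht.1 le_rfl ξ v
  have h0 : ∫ ω in univ, ‖S.Y ξ v ⟨t, left_mem_Icc.2 htT.le⟩ ω - ξ‖ ^ 2 ∂(S.P ξ v)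
      ≤ 0 * (S.P ξ v).real univ := by
    rw [setIntegral_univ, zero_mul, integral_eq_zero_of_ae]
    filter_upwards [hS.initial ξ v] with ω hω
    simp [hω]
  have h1 := (D.setIntegral_sq_dist_le (H := T + 1) (by linarith) (by linarith [ht.1])
    (s' := ⟨T, right_mem_Icc.2 htT.le⟩) htT.le MeasurableSet.univ h0).2
  simp only [setIntegral_univ, probReal_univ, mul_one, zero_add, ← hC] at h1
  have hsq := D.integrable_sq ⟨T, right_mem_Icc.2 htT.le⟩ ξ
  set Y := S.Y ξ v ⟨T, right_mem_Icc.2 htT.le⟩ with hY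
  have h2 : ∀ ω, g ξ - R * (1 + ‖Y ω - ξ‖ ^ 2) ≤ c T (Y ω) := by
    intro ω
    rw [hc.1]
    have h3 := hg.dist_le_mul ξ (Y ω)
    rw [dist_comm ξ, Real.dist_eq, dist_eq_norm] at h3
    have h4 : R * ‖Y ω - ξ‖ ≤ R * (1 + ‖Y ω - ξ‖ ^ 2) := by
      refine mul_le_mul_of_nonneg_left ?_ R.2
      nlinarith [sq_nonneg (‖Y ω - ξ‖ - 1), norm_nonneg (Y ω - ξ)]
    linarith [(le_abs_self _).trans h3]
  have h5' : Integrable (fun ω => 1 + ‖Y ω - ξ‖ ^ 2) (S.P ξ v) := (integrable_const _).add hsq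
  have h5 : Integrable (fun ω => g ξ - R * (1 + ‖Y ω - ξ‖ ^ 2)) (S.P ξ v) :=
    (integrable_const _).sub (h5'.const_mul _)
  have h6 := (integral_mono h5 (hS.integrable_c ξ v) h2).trans (hS.decrease ξ v)
  rw [integral_sub (integrable_const _) (h5'.const_mul _),
    integral_const_mul, integral_add (integrable_const _) hsq] at h6
  simp only [integral_const, probReal_univ, smul_eq_mul, one_mul] at h6
  have h7 : C * (T - t) ≤ |C| * T := by
    calc C * (T - t) ≤ |C| * (T - t) :=
          mul_le_mul_of_nonneg_right (le_abs_self _) (by linarith)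
      _ ≤ _ := mul_le_mul_of_nonneg_left (by linarith [ht.1]) (abs_nonneg _)
  have h8 : R * (1 + ∫ ω, ‖Y ω - ξ‖ ^ 2 ∂(S.P ξ v)) ≤ R * (1 + 2 * (|C| * T)) :=
    mul_le_mul_of_nonneg_left (by linarith) R.2
  linarith

end Stable

/-! ### Growth of second moments over a short time -/

/-- If the component of the drift along `ζ` is at most `Q / 2`, up to an error that is small near
`z`, then the mean square distance from a point `m` close to `z - ζ` grows at most at the rate
`M0 + Q + ‖ζ‖² / 2 + e`. The parameter `l` is the scale of the errors, and the term `‖ζ‖² / 2`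
absorbs the product of the error in the drift with `‖ζ‖`. -/
theorem QuadDyn.setIntegral_sq_le_of_drift {Ω : Type*} [mΩ : MeasurableSpace Ω] {a b : ℝ}
    {h : a ≤ b} {ℱ : Filtration (Icc a b) mΩ} {P : Measure Ω} [IsProbabilityMeasure P]
    {X : Icc a b → Ω → St d} {σ : ℝ → Ω → ℝ} {β : ℝ → Ω → St d} {M0 M1 : ℝ}
    (D : QuadDyn h ℱ P X σ β M0 M1) {H C : ℝ} (hH : 0 < H) (hbH : b - a ≤ H)
    (hC : M0 + 2 * H * M1 ^ 2 ≤ C) {s s' : Icc a b} (hs : s ≤ s') {A : Set Ω}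
    (hA : MeasurableSet[ℱ s] A) {m z ζ : St d} {l K Q e : ℝ} (hl : 0 < l)
    (hδ : ∫ ω in A, ‖X s ω - z‖ ^ 2 ∂P ≤ (s' - s) * P.real A)
    (hζ : ‖z - m - ζ‖ ≤ l)
    (hβ : ∀ᵐ ω ∂P, ω ∈ A → ∀ r ∈ Ioo (s : ℝ) s', inner ℝ ζ (β r ω) ≤
      Q / 2 + ‖ζ‖ * (l + K * ‖X (projIcc a b h r) ω - z‖))
    (he : l * M1 ^ 2 + 2 * l * M1 + 4 * l ^ 2
      + (1 / l + 4 * K ^ 2) * (2 * ((s' - s) + C * (s' - s))) ≤ e) :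
    ∫ ω in A, ‖X s' ω - m‖ ^ 2 ∂P ≤ ∫ ω in A, ‖X s ω - m‖ ^ 2 ∂P
      + (s' - s) * (M0 + Q + ‖ζ‖ ^ 2 / 2 + e) * P.real A := by
  have hs' : (s : ℝ) ≤ s' := hs
  have h1 := D.setIntegral_sq_le_of_near hH hbH hs hA (m := m) (z := z) hδ
    (c0 := M0 + Q + ‖ζ‖ ^ 2 / 2 + (l * M1 ^ 2 + 2 * l * M1 + 4 * l ^ 2))
    (c1 := 1 / l + 4 * K ^ 2) (by positivity) ?_
  · refine h1.trans ?_
    have h2 : (1 / l + 4 * K ^ 2) * (2 * ((s' - s) + (M0 + 2 * H * M1 ^ 2) * (s' - s)))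
        ≤ (1 / l + 4 * K ^ 2) * (2 * (((s' : ℝ) - s) + C * (s' - s))) := by
      have := mul_le_mul_of_nonneg_right hC (sub_nonneg.2 hs')
      refine mul_le_mul_of_nonneg_left ?_ (by positivity)
      linarith
    have h3 : ((s' : ℝ) - s) * (M0 + Q + ‖ζ‖ ^ 2 / 2 + (l * M1 ^ 2 + 2 * l * M1 + 4 * l ^ 2)
        + (1 / l + 4 * K ^ 2) * (2 * ((s' - s) + (M0 + 2 * H * M1 ^ 2) * (s' - s))))
        ≤ (s' - s) * (M0 + Q + ‖ζ‖ ^ 2 / 2 + e) :=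
      mul_le_mul_of_nonneg_left (by linarith) (sub_nonneg.2 hs')
    have := mul_le_mul_of_nonneg_right h3 (measureReal_nonneg (μ := P) (s := A))
    linarith
  · filter_upwards [hβ] with ω hω hωA r hr
    have hr' : r ∈ Icc a b := ⟨s.2.1.trans hr.1.le, hr.2.le.trans s'.2.2⟩
    have b1 := (le_abs_self _).trans (D.abs_σ_le r hr' ω)
    have b2 := D.norm_β_le r hr' ω
    have b3 := hω hωA r hr
    set x := X (projIcc a b h r) ω
    set b := β r ω
    have hM1 : 0 ≤ M1 := (norm_nonneg _).trans b2
    have e1 : inner ℝ (x - m) b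
        = inner ℝ (x - z) b + inner ℝ (z - m - ζ) b + inner ℝ ζ b := by
      rw [← inner_add_left, ← inner_add_left]
      congr 1
      abel
    have e2 : inner ℝ (x - z) b ≤ ‖x - z‖ * M1 :=
      (real_inner_le_norm _ _).trans (mul_le_mul_of_nonneg_left b2 (norm_nonneg _))
    have e3 : inner ℝ (z - m - ζ) b ≤ l * M1 :=
      (real_inner_le_norm _ _).trans (mul_le_mul hζ b2 (norm_nonneg _) hl.le)
    have e4 : 2 * (‖x - z‖ * M1) ≤ l * M1 ^ 2 + 1 / l * ‖x - z‖ ^ 2 := by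
      have e5 : l * M1 ^ 2 + 1 / l * ‖x - z‖ ^ 2 - 2 * (‖x - z‖ * M1)
          = 1 / l * (‖x - z‖ - l * M1) ^ 2 := by
        field_simp; ring
      have : 0 ≤ 1 / l * (‖x - z‖ - l * M1) ^ 2 := by positivity
      linarith
    have e6 : 2 * (‖ζ‖ * (l + K * ‖x - z‖)) ≤ ‖ζ‖ ^ 2 / 2 + 4 * l ^ 2
        + 4 * K ^ 2 * ‖x - z‖ ^ 2 := by
      nlinarith [sq_nonneg (‖ζ‖ - 2 * (l + K * ‖x - z‖)), sq_nonneg (l - K * ‖x - z‖)]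
    rw [quadRate, e1]
    linarith

/-! ### Step sizes -/

section Game

variable [MetricSpace U] [MetricSpace V] {L L₁ L₂ : Coefficients d U V} {T : ℝ}

/-- `b` moves by at most `l` when time advances by less than `h`. -/
def Coefficients.DriftModulus (L : Coefficients d U V) (T l h : ℝ) : Prop :=
  ∀ t ∈ Icc 0 T, ∀ r ∈ Icc 0 T, t < r → r < t + h → ∀ (x : St d) (u : U) (v : V),
    ‖L.drift r x u v - L.drift t x u v‖ ≤ l

theorem Coefficients.IsRegular.exists_driftModulus {M0 M1 : ℝ} {K : ℝ≥0}
    (hL : L.IsRegular T M0 M1 K) {l : ℝ} (hl : 0 < l) :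
    ∃ h₀ > 0, ∀ h ≤ h₀, L.DriftModulus T l h := by
  obtain ⟨α, -, hα, hα'⟩ := hL.modulus
  have h1 : ∀ᶠ δ in 𝓝[≠] (0 : ℝ), α δ < l ^ 2 := hα.eventually (gt_mem_nhds (by positivity))
  rw [eventually_nhdsWithin_iff, Metric.eventually_nhds_iff] at h1
  obtain ⟨h₀, hh₀, h2⟩ := h1
  refine ⟨h₀, hh₀, fun h hh t ht r hr htr hrt x u v => ?_⟩
  have h3 : α (r - t) < l ^ 2 := by
    refine h2 ?_ (sub_pos.2 htr).ne'
    rw [dist_zero_right, Real.norm_of_nonneg (by linarith)]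
    linarith
  exact le_of_sq_le_sq ((hα' r hr t ht x u v).trans h3.le) hl.le

/-- The step size `h` is so small that, with errors of scale `l`, the errors of one step are at
most `e`. -/
structure SmallStep (T : ℝ) (L₁ L₂ : Coefficients d U V) (M1 K C e l h : ℝ) : Prop where
  l_pos : 0 < l
  error_le : l * M1 ^ 2 + 2 * l * M1 + 4 * l ^ 2
    + (1 / l + 4 * K ^ 2) * (2 * (h + C * h)) ≤ e
  sq_le : 2 * (h + C * h) ≤ l ^ 2
  modulus₁ : L₁.DriftModulus T l h
  modulus₂ : L₂.DriftModulus T l h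

theorem exists_smallStep {M0₁ M1₁ M0₂ M1₂ : ℝ} {K₁ K₂ : ℝ≥0} (hL₁ : L₁.IsRegular T M0₁ M1₁ K₁)
    (hL₂ : L₂.IsRegular T M0₂ M1₂ K₂) {M1 K C e : ℝ} (hM1 : 0 ≤ M1) (hC : 0 ≤ C) (he : 0 < e) :
    ∃ l, ∃ h₀ > 0, ∀ h, 0 < h → h ≤ h₀ → SmallStep T L₁ L₂ M1 K C e l h := by
  set l := min 1 (e / (2 * (M1 ^ 2 + 2 * M1 + 4))) with hl
  have hl0 : 0 < l := lt_min one_pos (by positivity)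
  have hl1 : l ≤ 1 := min_le_left _ _
  have hl2 : l * (M1 ^ 2 + 2 * M1 + 4) ≤ e / 2 := by
    have : l ≤ e / (2 * (M1 ^ 2 + 2 * M1 + 4)) := min_le_right _ _
    rw [le_div_iff₀ (by positivity)] at this
    linarith
  obtain ⟨h₁, hh₁, hm₁⟩ := hL₁.exists_driftModulus hl0
  obtain ⟨h₂, hh₂, hm₂⟩ := hL₂.exists_driftModulus hl0
  set E := (1 / l + 4 * K ^ 2) * (2 * (1 + C)) with hE
  have hE0 : 0 < E := by positivity
  refine ⟨l, min (min h₁ h₂) (min (e / (2 * E)) (l ^ 2 / (2 * (1 + C)))), by positivity,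
    fun h hh hh0 => ?_⟩
  simp only [le_min_iff] at hh0
  obtain ⟨⟨i1, i2⟩, i3, i4⟩ := hh0
  rw [le_div_iff₀ (by positivity)] at i3 i4
  refine ⟨hl0, ?_, by linarith, hm₁ h i1, hm₂ h i2⟩
  have : l ^ 2 ≤ l := by nlinarith
  have : (1 / l + 4 * K ^ 2) * (2 * (h + C * h)) = h * E := by rw [hE]; ring
  nlinarith

theorem Coefficients.IsRegular.inner_drift_le {M0 M1 : ℝ} {K : ℝ≥0} {K' l h : ℝ}
    (hL : L.IsRegular T M0 M1 K) (hK : K ≤ K') (hm : L.DriftModulus T l h) {t r : ℝ}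
    (ht : t ∈ Icc 0 T) (hr : r ∈ Icc 0 T) (htr : t < r) (hrt : r < t + h) (ζ x z : St d)
    (u : U) (v : V) :
    inner ℝ ζ (L.drift r x u v) ≤ inner ℝ ζ (L.drift t z u v) + ‖ζ‖ * (l + K' * ‖x - z‖) := by
  have h1 := hm t ht r hr htr hrt z u v
  have h2 := (hL.lipschitz r hr u v).dist_le_mul x z
  rw [dist_eq_norm, dist_eq_norm] at h2
  have h3 : ‖L.drift r x u v - L.drift t z u v‖ ≤ l + K' * ‖x - z‖ := by
    rw [show L.drift r x u v - L.drift t z u v = (L.drift r z u v - L.drift t z u v)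
      + (L.drift r x u v - L.drift r z u v) by abel]
    have := mul_le_mul_of_nonneg_right hK (norm_nonneg (x - z))
    exact (norm_add_le _ _).trans (by linarith)
  have h4 : inner ℝ ζ (L.drift r x u v) = inner ℝ ζ (L.drift t z u v)
      + inner ℝ ζ (L.drift r x u v - L.drift t z u v) := by
    rw [← inner_add_right]; congr 1; abel
  rw [h4]
  have := (real_inner_le_norm ζ (L.drift r x u v - L.drift t z u v)).trans
    (mul_le_mul_of_nonneg_left h3 (norm_nonneg ζ))
  linarith

theorem Coefficients.IsRegular.mono {M0 M1 M1' : ℝ} {K : ℝ≥0} (hL : L.IsRegular T M0 M1 K)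
    (h : M1 ≤ M1') : L.IsRegular T M0 M1' K :=
  { hL with bounded := fun t ht x u v =>
      let ⟨h1, h2, h3⟩ := hL.bounded t ht x u v
      ⟨h1, h2, h3.trans h⟩ }

/-! ### Extremal controls -/

/-- Approximate saddle points exist when the lower and upper values of a bounded function agree. -/
theorem exists_approx_saddle {A B : Type*} [Nonempty A] [Nonempty B] {F : A → B → ℝ} {M : ℝ}
    (hF : ∀ a b, |F a b| ≤ M) (hval : ⨅ a, ⨆ b, F a b = ⨆ b, ⨅ a, F a b) {η : ℝ} (hη : 0 < η) :
    ∃ a₀ b₀, ∀ a b, F a₀ b ≤ F a b₀ + η := by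
  have hup : ∀ a, BddAbove (range (F a)) := fun a =>
    ⟨M, by rintro _ ⟨b, rfl⟩; exact (abs_le.1 (hF a b)).2⟩
  have hlow : ∀ b, BddBelow (range fun a => F a b) := fun b =>
    ⟨-M, by rintro _ ⟨a, rfl⟩; exact (abs_le.1 (hF a b)).1⟩
  obtain ⟨a₀, ha₀⟩ := exists_lt_of_ciInf_lt
    (show ⨅ a, ⨆ b, F a b < (⨅ a, ⨆ b, F a b) + η / 2 by linarith)
  obtain ⟨b₀, hb₀⟩ := exists_lt_of_lt_ciSup
    (show (⨆ b, ⨅ a, F a b) - η / 2 < ⨆ b, ⨅ a, F a b by linarith)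
  refine ⟨a₀, b₀, fun a b => ?_⟩
  have h1 := le_ciSup (hup a₀) b
  have h2 := ciInf_le (hlow b₀) a
  linarith

theorem sq_norm_drift_sub_le_kappa {M0₁ M1₁ M0₂ M1₂ : ℝ} {K₁ K₂ : ℝ≥0}
    (hL₁ : L₁.IsRegular T M0₁ M1₁ K₁) (hL₂ : L₂.IsRegular T M0₂ M1₂ K₂) {t : ℝ}
    (ht : t ∈ Icc 0 T) (x : St d) (u : U) (v : V) :
    ‖L₁.drift t x u v - L₂.drift t x u v‖ ^ 2 ≤ kappa T L₁ L₂ := by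
  refine le_ciSup (f := fun p : Icc 0 T × St d × U × V =>
    ‖L₁.drift p.1 p.2.1 p.2.2.1 p.2.2.2 - L₂.drift p.1 p.2.1 p.2.2.1 p.2.2.2‖ ^ 2)
    ⟨(M1₁ + M1₂) ^ 2, ?_⟩ (⟨t, ht⟩, x, u, v)
  rintro _ ⟨p, rfl⟩
  have h1 := (hL₁.bounded p.1 p.1.2 p.2.1 p.2.2.1 p.2.2.2).2.2
  have h2 := (hL₂.bounded p.1 p.1.2 p.2.1 p.2.2.1 p.2.2.2).2.2
  exact pow_le_pow_left₀ (norm_nonneg _) ((norm_sub_le _ _).trans (add_le_add h1 h2)) 2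

/-- The extremal shift: the first player chooses `u₀` against the motion, and the guide is driven
by `v₀`, so that the drifts bring the motion at `z` and the guide at `y` together, up to the
Lipschitz constant of the drift for which the Isaacs condition holds and to the discrepancy of
the drifts. -/
theorem exists_extremal {M0₁ M1₁ M0₂ M1₂ : ℝ} {K₁ K₂ : ℝ≥0} [Nonempty U] [Nonempty V]
    (hL₁ : L₁.IsRegular T M0₁ M1₁ K₁) (hL₂ : L₂.IsRegular T M0₂ M1₂ K₂)
    (hI : L₁.Isaacs T ∨ L₂.Isaacs T) {t : ℝ} (ht : t ∈ Icc 0 T) (z y : St d) {η : ℝ}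
    (hη : 0 < η) :
    ∃ (u₀ : U) (v₀ : V) (Q Q' : ℝ), (∀ v, inner ℝ (z - y) (L₁.drift t z u₀ v) ≤ Q / 2) ∧
      (∀ w, inner ℝ (y - z) (L₂.drift t y w v₀) ≤ Q' / 2) ∧
      Q + Q' = (beta T L₁ K₁ K₂ - 1) * ‖z - y‖ ^ 2 + kappa T L₁ L₂ + η := by
  have hb₁ := fun x u v => (hL₁.bounded t ht x u v).2.2
  have hb₂ := fun x u v => (hL₂.bounded t ht x u v).2.2
  have hbd : ∀ {M : ℝ} (ξ b : St d), ‖b‖ ≤ M → |inner ℝ ξ b| ≤ ‖ξ‖ * M := fun ξ b hb =>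
    (abs_real_inner_le_norm ξ b).trans (mul_le_mul_of_nonneg_left hb (norm_nonneg _))
  have hkap : ∀ x u v, 2 * inner ℝ (z - y) (L₁.drift t x u v - L₂.drift t x u v)
      ≤ ‖z - y‖ ^ 2 + kappa T L₁ L₂ := by
    intro x u v
    have h1 := sq_norm_drift_sub_le_kappa hL₁ hL₂ ht x u v
    have h2 := real_inner_le_norm (z - y) (L₁.drift t x u v - L₂.drift t x u v)
    nlinarith [sq_nonneg (‖z - y‖ - ‖L₁.drift t x u v - L₂.drift t x u v‖)]
  have hlip : ∀ {L : Coefficients d U V} {M0 M1 : ℝ} {K : ℝ≥0}, L.IsRegular T M0 M1 K →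
      ∀ u v, inner ℝ (z - y) (L.drift t z u v - L.drift t y u v) ≤ K * ‖z - y‖ ^ 2 := by
    intro L M0 M1 K hL u v
    have h1 := (hL.lipschitz t ht u v).dist_le_mul z y
    rw [dist_eq_norm, dist_eq_norm] at h1
    have h2 := real_inner_le_norm (z - y) (L.drift t z u v - L.drift t y u v)
    have h3 := mul_le_mul_of_nonneg_left h1 (norm_nonneg (z - y))
    linarith [h2.trans h3, sq ‖z - y‖, mul_left_comm ‖z - y‖ (K : ℝ) ‖z - y‖]
  have key : ∃ (u₀ : U) (v₀ : V), ∀ w v, 2 * inner ℝ (z - y) (L₁.drift t z u₀ v)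
      ≤ 2 * inner ℝ (z - y) (L₂.drift t y w v₀)
        + ((beta T L₁ K₁ K₂ - 1) * ‖z - y‖ ^ 2 + kappa T L₁ L₂ + η) := by
    by_cases h : L₁.Isaacs T
    · obtain ⟨u₀, v₀, hs⟩ := exists_approx_saddle
        (F := fun u v => inner ℝ (z - y) (L₁.drift t z u v))
        (fun u v => hbd _ _ (hb₁ z u v)) (h t ht z (z - y)) (half_pos hη)
      refine ⟨u₀, v₀, fun w v => ?_⟩
      have h1 := hs w v
      have h2 := hlip hL₁ w v₀
      have h3 := hkap y w v₀
      rw [inner_sub_right] at h2 h3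
      rw [beta, if_pos h]
      linarith
    · have h' := hI.resolve_left h
      obtain ⟨u₀, v₀, hs⟩ := exists_approx_saddle
        (F := fun u v => inner ℝ (z - y) (L₂.drift t z u v))
        (fun u v => hbd _ _ (hb₂ z u v)) (h' t ht z (z - y)) (half_pos hη)
      refine ⟨u₀, v₀, fun w v => ?_⟩
      have h1 := hs w v
      have h2 := hlip hL₂ w v₀
      have h3 := hkap z u₀ v
      rw [inner_sub_right] at h2 h3
      rw [beta, if_neg h]
      linarith
  obtain ⟨u₀, v₀, hk⟩ := key
  have hup : BddAbove (range fun v => inner ℝ (z - y) (L₁.drift t z u₀ v)) :=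
    ⟨‖z - y‖ * M1₁, by rintro _ ⟨v, rfl⟩; exact (abs_le.1 (hbd _ _ (hb₁ z u₀ v))).2⟩
  set q := ⨆ v, inner ℝ (z - y) (L₁.drift t z u₀ v) with hq
  refine ⟨u₀, v₀, 2 * q,
    (beta T L₁ K₁ K₂ - 1) * ‖z - y‖ ^ 2 + kappa T L₁ L₂ + η - 2 * q, fun v => ?_, fun w => ?_,
    by ring⟩
  · have := le_ciSup hup v
    linarith
  · have h1 : q ≤ inner ℝ (z - y) (L₂.drift t y w v₀)
        + ((beta T L₁ K₁ K₂ - 1) * ‖z - y‖ ^ 2 + kappa T L₁ L₂ + η) / 2 :=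
      ciSup_le fun v => by linarith [hk w v]
    rw [← neg_sub z y, inner_neg_left]
    linarith

/-! ### One step of the motion and of the guide -/

variable [CompactSpace U] [MeasurableSpace U] [BorelSpace U]
  [CompactSpace V] [MeasurableSpace V] [BorelSpace V]
  {M0 M1 K' C e l : ℝ} {K : ℝ≥0} {𝒟 : Set (St d → ℝ)}

theorem StabilityData.IsAdmissible.integral_sq_le {t θ : ℝ} {h : t ≤ θ}
    {S : StabilityData d U V t θ} {c : ℝ → St d → ℝ}
    (hS : S.IsAdmissible h L₂ 𝒟 c) (hL : L₂.IsRegular T M0 M1 K) (hK : K ≤ K')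
    (hC : M0 + 2 * (T + 1) * M1 ^ 2 ≤ C) (h𝒟 : IsTestClass 𝒟) (ht : 0 ≤ t) (hθ : θ ≤ T)
    (hstep : SmallStep T L₁ L₂ M1 K' C e l (θ - t)) (y z : St d) (v : V) {Q : ℝ}
    (hQ : ∀ w, inner ℝ (y - z) (L₂.drift t y w v) ≤ Q / 2) :
    ∫ ω, ‖S.Y y v ⟨θ, right_mem_Icc.2 h⟩ ω - z‖ ^ 2 ∂(S.P y v) ≤
        ‖y - z‖ ^ 2 + (θ - t) * (M0 + Q + ‖y - z‖ ^ 2 / 2 + e) ∧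
      ∫ ω, ‖S.Y y v ⟨θ, right_mem_Icc.2 h⟩ ω - y‖ ^ 2 ∂(S.P y v) ≤ l ^ 2 := by
  have := hS.isProbability y v
  have D := hS.quadDyn hL h𝒟 ht hθ y v
  have hT : 0 ≤ T := ht.trans (h.trans hθ)
  have hin : ∀ x : St d, ∫ ω in univ, ‖S.Y y v ⟨t, left_mem_Icc.2 h⟩ ω - x‖ ^ 2 ∂(S.P y v)
      = ‖y - x‖ ^ 2 := by
    intro x
    rw [setIntegral_univ]
    have : ∀ᵐ ω ∂(S.P y v), ‖S.Y y v ⟨t, left_mem_Icc.2 h⟩ ω - x‖ ^ 2 = ‖y - x‖ ^ 2 := by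
      filter_upwards [hS.initial y v] with ω hω
      rw [hω]
    rw [integral_congr_ae this]
    simp
  have hδ : ∫ ω in univ, ‖S.Y y v ⟨t, left_mem_Icc.2 h⟩ ω - y‖ ^ 2 ∂(S.P y v)
      ≤ (θ - t) * (S.P y v).real univ := by
    rw [hin, sub_self, norm_zero]
    simpa using h
  have hss : (⟨t, left_mem_Icc.2 h⟩ : Icc t θ) ≤ ⟨θ, right_mem_Icc.2 h⟩ := h
  have h1 := D.setIntegral_sq_le_of_drift (H := T + 1) (by linarith) (by linarith) hC hss
    MeasurableSet.univ (m := z) (z := y) (ζ := y - z) (l := l) (K := K') (Q := Q) (e := e)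
    hstep.l_pos hδ (by simpa using hstep.l_pos.le) ?_ hstep.error_le
  · have h2 := (D.setIntegral_sq_dist_le (H := T + 1) (by linarith) (by linarith) hss
      MeasurableSet.univ hδ).2
    rw [hin] at h1
    simp only [setIntegral_univ, probReal_univ, mul_one] at h1 h2
    refine ⟨h1, h2.trans (le_trans ?_ hstep.sq_le)⟩
    have := mul_le_mul_of_nonneg_right hC (sub_nonneg.2 h)
    linarith
  · refine Eventually.of_forall fun ω _ r hr => ?_
    have hr' : r ∈ Icc t θ := ⟨hr.1.le, hr.2.le⟩
    have hr0 : r ∈ Icc 0 T := ⟨ht.trans hr'.1, hr'.2.trans hθ⟩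
    simp only [StabilityData.drift, projIcc_of_mem h hr']
    set x := S.Y y v ⟨r, hr'⟩ ω
    set μ : Measure U := (S.μ y v ⟨r, hr'⟩ ω : Measure U)
    have hd := hL.integrable_drift hr0 x v μ
    rw [← integral_inner hd]
    have h3 : ∀ w, inner ℝ (y - z) (L₂.drift r x w v) ≤
        Q / 2 + ‖y - z‖ * (l + K' * ‖x - y‖) := by
      intro w
      have := hL.inner_drift_le hK hstep.modulus₂ ⟨ht, h.trans hθ⟩ hr0 hr.1
        (by linarith [hr.2]) (y - z) x y w v
      linarith [hQ w]
    have := integral_mono (hd.const_inner (y - z))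
      (integrable_const (Q / 2 + ‖y - z‖ * (l + K' * ‖x - y‖))) h3
    simpa using this

theorem Motion.setIntegral_sq_le {t₀ : ℝ} {h : t₀ ≤ T} {x₀ : St d} {𝔲 : Strategy d U t₀ T}
    {𝔳 : Strategy d V t₀ T} (m : Motion L₁ 𝒟 h x₀ 𝔲 𝔳) (hL : L₁.IsRegular T M0 M1 K)
    (hK : K ≤ K') (hC : M0 + 2 * (T + 1) * M1 ^ 2 ≤ C) (h𝒟 : IsTestClass 𝒟) (ht₀ : 0 ≤ t₀)
    {s s' : Icc t₀ T} (hs : s ≤ s') (hstep : SmallStep T L₁ L₂ M1 K' C e l (s' - s))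
    {A : Set (m.Ω × 𝔲.Ω × 𝔳.Ω)} (hA : MeasurableSet[m.filtration s] A) {y z c : St d}
    (hX : ∀ ω ∈ A, ‖m.X ω s - z‖ ^ 2 ≤ s' - s) {u : U}
    (hu : ∀ ω ∈ A, ∀ r ∈ Ioo (s : ℝ) s',
      𝔲.control (m.X ω) (projIcc t₀ T h r) ω.2.1 = u) {Q : ℝ}
    (hQ : ∀ v, inner ℝ (z - y) (L₁.drift s z u v) ≤ Q / 2) (hc : ‖c - y‖ ≤ l) :
    ∫ ω in A, ‖m.X ω s' - c‖ ^ 2 ∂m.P ≤ ∫ ω in A, ‖m.X ω s - c‖ ^ 2 ∂m.P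
      + (s' - s) * (M0 + Q + ‖z - y‖ ^ 2 / 2 + e) * m.P.real A := by
  have D := m.quadDyn hL h𝒟 ht₀
  have hA' : MeasurableSet A := m.filtration.le s A hA
  refine D.setIntegral_sq_le_of_drift (H := T + 1) (by linarith) (by linarith) hC hs
    hA (m := c) (z := z) (ζ := z - y) (l := l) (K := K') (Q := Q) (e := e)
    hstep.l_pos ?_ ?_ ?_ hstep.error_le
  · have h1 := setIntegral_mono_on (D.integrable_sq s z).integrableOn
      (integrable_const ((s' : ℝ) - s)).integrableOn hA' hX
    rwa [setIntegral_const, smul_eq_mul, mul_comm] at h1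
  · rw [show z - c - (z - y) = -(c - y) by abel, norm_neg]
    exact hc
  · refine Eventually.of_forall fun ω hω r hr => ?_
    have hr' : r ∈ Icc t₀ T := ⟨s.2.1.trans hr.1.le, hr.2.le.trans s'.2.2⟩
    have hr0 : r ∈ Icc 0 T := ⟨ht₀.trans hr'.1, hr'.2⟩
    have hu' := hu ω hω r hr
    simp only [Motion.drift]
    rw [hu']
    simp only [projIcc_of_mem h hr']
    have := hL.inner_drift_le hK hstep.modulus₁ ⟨ht₀.trans s.2.1, s.2.2⟩ hr0 hr.1
      (by linarith [hr.2]) (z - y) (m.X ω ⟨r, hr'⟩) z u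
      (𝔳.control (m.X ω) ⟨r, hr'⟩ ω.2.2)
    linarith [hQ (𝔳.control (m.X ω) ⟨r, hr'⟩ ω.2.2)]

end Game

/-! ### Proximal aiming -/

section Game

variable [MetricSpace U] [MetricSpace V] {L₁ L₂ : Coefficients d U V} {T : ℝ}
  [CompactSpace U] [MeasurableSpace U] [BorelSpace U] [Nonempty U]
  [CompactSpace V] [MeasurableSpace V] [BorelSpace V] [Nonempty V]
  {M0₁ M0₂ M1 K' C e l B : ℝ} {K₁ K₂ R : ℝ≥0} {𝒟₁ 𝒟₂ : Set (St d → ℝ)}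
  {g : St d → ℝ} {c : ℝ → St d → ℝ}

/-- Proximal aiming over one step. The control is a measurable function of the state at the
beginning of the step; the inf-convolution of `c` evaluated along the motion increases in mean by
at most `p' Θ` per unit of time, up to the errors of the step. The state space is cut into
countably many pieces with one aiming point `y` and one guide each. On each piece the motion is
compared with an independent copy of the guide that starts at `y`. -/
theorem exists_step_control (hL₁ : L₁.IsRegular T M0₁ M1 K₁) (hL₂ : L₂.IsRegular T M0₂ M1 K₂)
    (hK₁ : K₁ ≤ K') (hK₂ : K₂ ≤ K') (hC₁ : M0₁ + 2 * (T + 1) * M1 ^ 2 ≤ C)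
    (hC₂ : M0₂ + 2 * (T + 1) * M1 ^ 2 ≤ C) (h𝒟₁ : IsTestClass 𝒟₁) (h𝒟₂ : IsTestClass 𝒟₂)
    (hg : LipschitzWith R g) (hI : L₁.Isaacs T ∨ L₂.Isaacs T) (hc : IsUStable T L₂ 𝒟₂ g c)
    (hlow : ∀ t ∈ Icc 0 T, ∀ ξ, g ξ - B ≤ c t ξ) (he : 0 < e) {t₀ : ℝ} (ht₀ : 0 ≤ t₀)
    {s s' : Icc t₀ T} (hss : s < s') (hstep : SmallStep T L₁ L₂ M1 K' C e l (s' - s))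
    {p p' : ℝ} (hp' : 0 < p') (hp : p = p' * Real.exp (beta T L₁ K₁ K₂ * (s' - s))) :
    ∃ κ : St d → U, Measurable κ ∧ ∀ (h : t₀ ≤ T) (x₀ : St d) (𝔲 : Strategy d U t₀ T)
      (𝔳 : Strategy d V t₀ T) (m : Motion L₁ 𝒟₁ h x₀ 𝔲 𝔳),
      (∀ ω, ∀ r ∈ Ioo (s : ℝ) s', 𝔲.control (m.X ω) (projIcc t₀ T h r) ω.2.1 = κ (m.X ω s)) →
      ∫ ω, infConv p' (c s') (m.X ω s') ∂m.P ≤ ∫ ω, infConv p (c s) (m.X ω s) ∂m.P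
        + (s' - s) * (p' * (Theta T L₁ L₂ M0₁ M0₂ + 4 * e) + 2 * e) := by
  have hss' : (s : ℝ) < s' := hss
  have hsT : (s : ℝ) ∈ Icc 0 T := ⟨ht₀.trans s.2.1, s.2.2⟩
  have hsT' : (s' : ℝ) ∈ Icc 0 T := ⟨ht₀.trans s'.2.1, s'.2.2⟩
  have hp0 : 0 < p := by rw [hp]; positivity
  obtain ⟨S, hS⟩ := hc.2 s s' hsT.1 hss' hsT'.2
  set η := (s' : ℝ) - s with hη
  have hη0 : 0 < η := sub_pos.2 hss'
  choose y hy using fun z => exists_lt_infConv_add p (c s) z (mul_pos he hη0)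
  choose u v Q Q' hQ hQ' hQQ using fun z => exists_extremal hL₁ hL₂ hI hsT z (y z) he
  set Y : St d → S.Ω → St d := fun z => S.Y (y z) (v z) ⟨s', right_mem_Icc.2 hss'.le⟩ with hY
  set F : St d → St d → ℝ := fun z x => ∫ ω, ‖Y z ω - x‖ ^ 2 ∂(S.P (y z) (v z)) with hF
  set a : St d → St d := fun z => ∫ ω, Y z ω ∂(S.P (y z) (v z)) with ha
  have hprob := fun z => hS.isProbability (y z) (v z)
  have hD := fun z => hS.quadDyn hL₂ h𝒟₂ hsT.1 hsT'.2 (y z) (v z)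
  have hYsq : ∀ z x, Integrable (fun ω => ‖Y z ω - x‖ ^ 2) (S.P (y z) (v z)) :=
    fun z x => (hD z).integrable_sq _ x
  have hFa : ∀ z x, F z x = ‖x - a z‖ ^ 2 + F z (a z) := fun z x => by
    obtain ⟨_, hB⟩ := (hD z).exists_integral_norm_le
    exact integral_sq_dist_eq (hB _).1 (hYsq z) x
  have hF0 : ∀ z x, 0 ≤ F z x := fun z x => integral_nonneg fun ω => by positivity
  have hguide := fun z => hS.integral_sq_le hL₂ hK₂ hC₂ h𝒟₂ hsT.1 hsT'.2 hstep (y z) z (v z)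
    (hQ' z)
  have hay : ∀ z, ‖a z - y z‖ ≤ l := by
    intro z
    refine le_of_sq_le_sq ?_ hstep.l_pos.le
    have h1 := (hguide z).2
    have h2 := hFa z (y z)
    rw [norm_sub_rev]
    linarith [hF0 z (a z)]
  have hwc := continuous_infConv hg (hlow s hsT) hp0
  have hFc : ∀ z, Continuous (F z) := by
    intro z
    rw [show F z = fun x => ‖x - a z‖ ^ 2 + F z (a z) from funext (hFa z)]
    fun_prop
  set O : St d → Set (St d) := fun z => {x | ‖x - z‖ ^ 2 < η ∧
    infConv p (c s) z < infConv p (c s) x + e * η ∧ F z x < F z z + e * η} with hO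
  have hOo : ∀ z, IsOpen (O z) := by
    intro z
    have o1 : IsOpen {x | ‖x - z‖ ^ 2 < η} := isOpen_lt (by fun_prop) continuous_const
    have o2 : IsOpen {x | infConv p (c s) z < infConv p (c s) x + e * η} :=
      isOpen_lt continuous_const (hwc.add continuous_const)
    exact o1.inter (o2.inter (isOpen_lt (hFc z) continuous_const))
  have heη : 0 < e * η := mul_pos he hη0
  obtain ⟨zn, N, hN, hNO⟩ := exists_measurable_nat_cover
    (fun z => (hOo z).mem_nhds (show z ∈ O z by simp [hO, hη0, heη]))
    (fun z => (hOo z).measurableSet)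
  refine ⟨fun x => u (zn (N x)), (measurable_of_countable fun n => u (zn n)).comp hN,
    fun h x₀ 𝔲 𝔳 m hm => ?_⟩
  have D := m.quadDyn hL₁ h𝒟₁ ht₀
  set E := p' * (Theta T L₁ L₂ M0₁ M0₂ + 4 * e) + 2 * e with hE
  have hi := D.integrable_infConv hg (hlow s hsT) hp0 s
  have hi' := D.integrable_infConv hg (hlow s' hsT') hp' s'
  have hi2 : Integrable (fun ω => infConv p (c s) (m.X ω s) + η * E) m.P :=
    hi.add (integrable_const _)
  suffices hfib : ∫ ω, (infConv p' (c s') (m.X ω s')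
      - (infConv p (c s) (m.X ω s) + η * E)) ∂m.P ≤ 0 by
    rw [integral_sub hi' hi2, integral_add hi (integrable_const _)] at hfib
    simp only [integral_const, probReal_univ, smul_eq_mul, one_mul] at hfib
    linarith
  refine integral_nonpos_of_fiber (N := fun ω => N (m.X ω s)) (hi'.sub hi2)
    (hN.comp (m.measurable_eval s)) fun n => ?_
  set A : Set (m.Ω × 𝔲.Ω × 𝔳.Ω) := (fun ω => N (m.X ω s)) ⁻¹' {n} with hA
  have hAm : MeasurableSet[m.filtration s] A :=
    (hN.comp (m.adapted s)) (measurableSet_singleton n)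
  have hAm' : MeasurableSet A := m.filtration.le s A hAm
  have hAO : ∀ ω ∈ A, m.X ω s ∈ O (zn n) := by
    intro ω hω
    have h1 : N (m.X ω s) = n := hω
    have := hNO (m.X ω s)
    rwa [h1] at this
  set z := zn n with hz
  set PA := m.P.real A with hPA
  have hPA0 : 0 ≤ PA := measureReal_nonneg
  have hconst : ∀ q : ℝ, ∫ ω in A, q ∂m.P = PA * q := fun q => by
    rw [setIntegral_const, smul_eq_mul]
  -- The inf-convolution is bounded by its values at the end points of the guide.
  have h1 : ∀ x, infConv p' (c s') x ≤ c s (y z) + p' * (‖x - a z‖ ^ 2 + F z (a z)) := by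
    intro x
    have hcY := hS.integrable_c (y z) (v z)
    have i2 := integral_mono (integrable_const (infConv p' (c s') x))
      (hcY.add ((hYsq z x).const_mul p')) fun ω => by
        have := infConv_le hg (hlow s' hsT') hp' x (Y z ω)
        rw [norm_sub_rev] at this
        exact this
    simp only [Pi.add_apply] at i2
    rw [integral_add hcY ((hYsq z x).const_mul p'), integral_const_mul] at i2
    simp only [integral_const, probReal_univ, smul_eq_mul, one_mul] at i2
    have i3 := hS.decrease (y z) (v z)
    have i4 := hFa z x
    rw [← i4]
    linarith
  have hsqa' := (D.integrable_sq s' (a z)).integrableOn (s := A)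
  have hsqa := (D.integrable_sq s (a z)).integrableOn (s := A)
  have h2 : ∫ ω in A, infConv p' (c s') (m.X ω s') ∂m.P ≤
      PA * (c s (y z) + p' * F z (a z)) + p' * ∫ ω in A, ‖m.X ω s' - a z‖ ^ 2 ∂m.P := by
    have i1 : IntegrableOn (fun ω => (c s (y z) + p' * F z (a z))
        + p' * ‖m.X ω s' - a z‖ ^ 2) A m.P := (integrable_const _).add (hsqa'.const_mul _)
    refine (setIntegral_mono hi'.integrableOn i1 fun ω => ?_).trans_eq ?_
    · linarith [h1 (m.X ω s')]
    · rw [integral_add (integrable_const _) (hsqa'.const_mul _), hconst, integral_const_mul]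
  -- The motion over the step, seen from the mean of the guide.
  have h3 := m.setIntegral_sq_le hL₁ hK₁ hC₁ h𝒟₁ ht₀ hss.le hstep hAm (y := y z) (z := z)
    (c := a z) (fun ω hω => (hAO ω hω).1.le) (u := u z)
    (fun ω hω r hr => by
      have hNω : N (m.X ω s) = n := hω
      have := hm ω r hr
      beta_reduce at this
      rwa [hNω] at this)
    (hQ z) (hay z)
  -- On `A` the state lies in `O z`, so it may be replaced by `z`.
  have h4 : ∫ ω in A, ‖m.X ω s - a z‖ ^ 2 ∂m.P ≤ PA * (F z z + e * η - F z (a z)) := by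
    rw [← hconst]
    refine setIntegral_mono_on hsqa (integrable_const _).integrableOn hAm' fun ω hω => ?_
    have i1 := (hAO ω hω).2.2
    rw [hFa z (m.X ω s)] at i1
    linarith
  have h5 : PA * (infConv p (c s) z - e * η) ≤ ∫ ω in A, infConv p (c s) (m.X ω s) ∂m.P := by
    rw [← hconst]
    refine setIntegral_mono_on (integrable_const _).integrableOn hi.integrableOn hAm'
      fun ω hω => ?_
    linarith [(hAO ω hω).2.1]
  -- `1 + β η ≤ e^{β η}` turns the growth of the squared distance into the ratio of the penalties.
  have h6 : c s (y z) + p' * (F z z + e * η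
      + η * (M0₁ + Q z + ‖z - y z‖ ^ 2 / 2 + e)) ≤ infConv p (c s) z - e * η + η * E := by
    have i1 := (hguide z).1
    rw [norm_sub_rev] at i1
    have i2 := hy z
    have i3 := hQQ z
    set D2 := ‖z - y z‖ ^ 2 with hD2
    have hD20 : 0 ≤ D2 := by positivity
    have i4 : p' * (1 + beta T L₁ K₁ K₂ * η) ≤ p := by
      rw [hp]
      refine mul_le_mul_of_nonneg_left ?_ hp'.le
      linarith [Real.add_one_le_exp (beta T L₁ K₁ K₂ * η)]
    have i5 := mul_le_mul_of_nonneg_right i4 hD20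
    have i6 : F z z + e * η + η * (M0₁ + Q z + D2 / 2 + e) ≤
        (1 + beta T L₁ K₁ K₂ * η) * D2 + η * (Theta T L₁ L₂ M0₁ M0₂ + 4 * e) := by
      have i7 : F z z ≤ D2 + η * (M0₂ + Q' z + D2 / 2 + e) := i1
      have i8 : η * (Q z + Q' z) = η * ((beta T L₁ K₁ K₂ - 1) * D2 + kappa T L₁ L₂ + e) := by
        rw [i3]
      rw [Theta]
      linarith
    have i9 := mul_le_mul_of_nonneg_left i6 hp'.le
    rw [hE]
    linarith
  have h7 := mul_le_mul_of_nonneg_left h6 hPA0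
  have h8 := mul_le_mul_of_nonneg_left h3 hp'.le
  have h9 := mul_le_mul_of_nonneg_left h4 hp'.le
  rw [integral_sub hi'.integrableOn hi2.integrableOn,
    integral_add hi.integrableOn (integrable_const _), hconst]
  linarith

end Game

/-! ### Stepwise strategies from measurable feedback maps -/

section Strategy

variable {t₀ T : ℝ}

/-- The `k`-th node `t₀ + k δ`, kept inside `[t₀, T]`. -/
noncomputable def node (h : t₀ ≤ T) (δ : ℝ) (k : ℕ) : Icc t₀ T := projIcc t₀ T h (t₀ + k * δ)

/-- The index of the step that contains the time `s`. -/
noncomputable def stepIndex (δ : ℝ) (s : Icc t₀ T) : ℕ := ⌊((s : ℝ) - t₀) / δ⌋₊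

theorem node_stepIndex_le (h : t₀ ≤ T) {δ : ℝ} (hδ : 0 ≤ δ) (s : Icc t₀ T) :
    node h δ (stepIndex δ s) ≤ s := by
  have h1 : t₀ + stepIndex δ s * δ ≤ s := by
    have hs : 0 ≤ (s : ℝ) - t₀ := sub_nonneg.2 s.2.1
    rcases hδ.eq_or_lt with rfl | hδ
    · simpa using s.2.1
    · have := Nat.floor_le (div_nonneg hs hδ.le)
      rw [le_div_iff₀ hδ] at this
      simp only [stepIndex]
      linarith
  have := monotone_projIcc h h1
  rwa [projIcc_val] at this

theorem node_val (h : t₀ ≤ T) {δ : ℝ} (hδ : 0 ≤ δ) {n k : ℕ} (hn : t₀ + n * δ = T)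
    (hk : k ≤ n) : (node h δ k : ℝ) = t₀ + k * δ := by
  have h1 : (k : ℝ) * δ ≤ n * δ := mul_le_mul_of_nonneg_right (by exact_mod_cast hk) hδ
  have h2 : 0 ≤ (k : ℝ) * δ := by positivity
  rw [node, projIcc_of_mem h ⟨by linarith, by linarith⟩]

theorem stepIndex_eq {δ : ℝ} (hδ : 0 < δ) {k : ℕ} {s : Icc t₀ T}
    (h₁ : t₀ + k * δ ≤ s) (h₂ : s < t₀ + (k + 1) * δ) : stepIndex δ s = k := by
  rw [stepIndex, Nat.floor_eq_iff (div_nonneg (sub_nonneg.2 s.2.1) hδ.le), le_div_iff₀ hδ,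
    div_lt_iff₀ hδ]
  exact ⟨by linarith, by linarith⟩

theorem measurable_stepIndex (δ : ℝ) : Measurable (stepIndex δ : Icc t₀ T → ℕ) :=
  Nat.measurable_floor.comp ((measurable_subtype_coe.sub_const t₀).div_const δ)

theorem measurable_eval_pathFiltration {r t : Icc t₀ T} (hr : r ≤ t) :
    Measurable[pathFiltration d t₀ T t] fun x : Path d t₀ T => x r := by
  rw [measurable_iff_comap_le]
  exact le_iSup₂ (f := fun (r : Icc t₀ T) (_ : r ≤ t) =>
    MeasurableSpace.comap (fun x : Path d t₀ T => x r) inferInstance) r hr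

theorem measurable_uncurry_comp_index {E S Ω A : Type*} [MeasurableSpace E] [MeasurableSpace S]
    [MeasurableSpace Ω] [MeasurableSpace A] {G : ℕ → E → A} (hG : ∀ k, Measurable (G k))
    {i : S → ℕ} (hi : Measurable i) : Measurable fun p : E × S × Ω => G (i p.2.1) p.1 := by
  have h1 : Measurable fun q : ℕ × E => G q.1 q.2 := measurable_from_prod_countable_right hG
  exact h1.comp ((hi.comp (measurable_fst.comp measurable_snd)).prodMk measurable_fst)

variable [MetricSpace U] [CompactSpace U] [MeasurableSpace U] [BorelSpace U]

/-- The deterministic strategy that on the `k`-th step uses the constant control `κ k x`, where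
`x` is the state at the beginning of the step. -/
noncomputable def stepStrategy (h : t₀ ≤ T) {δ : ℝ} (hδ : 0 ≤ δ) {κ : ℕ → St d → U}
    (hκ : ∀ k, Measurable (κ k)) : Strategy d U t₀ T where
  Ω := Unit
  mΩ := inferInstance
  ℱ := ⊤
  control x s _ := κ (stepIndex δ s) (x (node h δ (stepIndex δ s)))
  P _ := Measure.dirac ()
  isProbability _ := inferInstance
  progressive x t := by
    have h1 : Measurable fun s : Icc t₀ T =>
        κ (stepIndex δ s) (x (node h δ (stepIndex δ s))) :=
      (measurable_of_countable fun k : ℕ => κ k (x (node h δ k))).comp (measurable_stepIndex δ)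
    have h2 : Measurable fun p : Iic t × Unit =>
        κ (stepIndex δ p.1.1) (x (node h δ (stepIndex δ p.1.1))) :=
      h1.comp (measurable_subtype_coe.comp measurable_fst)
    exact h2.stronglyMeasurable
  nonanticipating t x y hxy :=
    ⟨fun _ _ => rfl, fun s hs => Eventually.of_forall fun _ => by
      rw [hxy _ ((node_stepIndex_le h hδ s).trans hs)]⟩
  measurable_control t := by
    have h1 : ∀ k, Measurable[pathFiltration d t₀ T t] fun x : Path d t₀ T =>
        κ k (x (min (node h δ k) t)) := fun k =>
      (hκ k).comp (measurable_eval_pathFiltration (min_le_right _ _))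
    have h2 := @measurable_uncurry_comp_index (Path d t₀ T) (Iic t) Unit U
      (pathFiltration d t₀ T t) _ _ _ _ h1 (fun s => stepIndex δ s.1)
      ((measurable_stepIndex δ).comp measurable_subtype_coe)
    have h3 : (fun p : Path d t₀ T × Iic t × Unit =>
        κ (stepIndex δ p.2.1.1) (p.1 (node h δ (stepIndex δ p.2.1.1)))) =
        fun p => κ (stepIndex δ p.2.1.1) (p.1 (min (node h δ (stepIndex δ p.2.1.1)) t)) := by
      funext p
      rw [min_eq_left ((node_stepIndex_le h hδ p.2.1.1).trans p.2.1.2)]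
    rw [h3]
    exact h2

theorem stepStrategy_isDeterministic (h : t₀ ≤ T) {δ : ℝ} (hδ : 0 ≤ δ) {κ : ℕ → St d → U}
    (hκ : ∀ k, Measurable (κ k)) : (stepStrategy h hδ hκ).IsDeterministic :=
  inferInstanceAs (Subsingleton Unit)

theorem stepStrategy_isStepwise (h : t₀ ≤ T) {δ : ℝ} (hδ : 0 ≤ δ) {κ : ℕ → St d → U}
    (hκ : ∀ k, Measurable (κ k)) {n : ℕ} (hn : t₀ + n * δ = T) :
    (stepStrategy h hδ hκ).IsStepwise := by
  classical
  refine ⟨(Finset.range (n + 1)).image (node h δ), fun s hs => ?_, fun τ _ x y hxy =>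
    ⟨fun _ _ => rfl, fun s hs ω => ?_⟩⟩
  · rw [Finset.mem_image]
    rcases hs with hs | hs
    · refine ⟨0, by simp, Subtype.ext ?_⟩
      rw [node_val h hδ hn (Nat.zero_le n), hs]; simp
    · refine ⟨n, by simp, Subtype.ext ?_⟩
      rw [node_val h hδ hn le_rfl, hs, hn]
  · have h1 : stepIndex δ s ≤ n := by
      refine Nat.floor_le_of_le (div_le_of_le_mul₀ hδ (by positivity) ?_)
      linarith [s.2.2]
    have h2 := hxy (node h δ (stepIndex δ s))
      (Finset.mem_image_of_mem _ (Finset.mem_range.2 (Nat.lt_succ_of_le h1)))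
      ((node_stepIndex_le h hδ s).trans_lt hs)
    exact congrArg (κ (stepIndex δ s)) h2

end Strategy

/-! ### The bound for the payoff -/

section Game

theorem beta_nonneg (T : ℝ) (L₁ : Coefficients d U V) (K₁ K₂ : ℝ≥0) : 0 ≤ beta T L₁ K₁ K₂ := by
  rw [beta]
  split_ifs <;> positivity

variable [MetricSpace U] [MetricSpace V] [Nonempty U] [Nonempty V]
  {L₁ L₂ : Coefficients d U V} {T M0₁ M0₂ M1₁ M1₂ : ℝ} {K₁ K₂ R : ℝ≥0}

theorem Coefficients.IsRegular.M0_nonneg (hL : L₁.IsRegular T M0₁ M1₁ K₁) (hT : 0 ≤ T) :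
    0 ≤ M0₁ := by
  obtain ⟨u⟩ := ‹Nonempty U›
  obtain ⟨v⟩ := ‹Nonempty V›
  exact (abs_nonneg _).trans (hL.bounded 0 ⟨le_rfl, hT⟩ 0 u v).2.1

theorem Theta_nonneg (hL₁ : L₁.IsRegular T M0₁ M1₁ K₁) (hL₂ : L₂.IsRegular T M0₂ M1₂ K₂)
    (hT : 0 ≤ T) : 0 ≤ Theta T L₁ L₂ M0₁ M0₂ := by
  have h1 := hL₁.M0_nonneg hT
  have h2 := hL₂.M0_nonneg hT
  have h3 : 0 ≤ kappa T L₁ L₂ := Real.iSup_nonneg fun p => by positivity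
  rw [Theta]
  linarith

variable [MeasurableSpace U] [MeasurableSpace V] [CompactSpace U] [BorelSpace U]
  [CompactSpace V] [BorelSpace V] {𝒟₁ 𝒟₂ : Set (St d → ℝ)} {g : St d → ℝ} {c : ℝ → St d → ℝ}

/-- The bound that proximal aiming with the penalty `p ‖·‖²` at the terminal time achieves. -/
theorem exists_strategy_payoff_le (hL₁ : L₁.IsRegular T M0₁ M1₁ K₁)
    (hL₂ : L₂.IsRegular T M0₂ M1₂ K₂) (h𝒟₁ : IsTestClass 𝒟₁) (h𝒟₂ : IsTestClass 𝒟₂)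
    (hg : LipschitzWith R g) (hI : L₁.Isaacs T ∨ L₂.Isaacs T) (hc : IsUStable T L₂ 𝒟₂ g c)
    {e : ℝ} (he : 0 < e) {t₀ : ℝ} (ht₀ : 0 ≤ t₀) (h : t₀ < T) (x₀ : St d) {p : ℝ}
    (hp : 0 < p) :
    ∃ 𝔲 : Strategy d U t₀ T, 𝔲.IsStepwise ∧ 𝔲.IsDeterministic ∧
      ∀ (𝔳 : Strategy d V t₀ T) (m : Motion L₁ 𝒟₁ h.le x₀ 𝔲 𝔳),
        m.payoff g ≤ c t₀ x₀ + T * (p * Real.exp (beta T L₁ K₁ K₂ * T)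
          * (Theta T L₁ L₂ M0₁ M0₂ + 4 * e) + 2 * e) + R ^ 2 / (4 * p) := by
  have hT : 0 ≤ T := ht₀.trans h.le
  set b := beta T L₁ K₁ K₂ with hb
  have hb0 : 0 ≤ b := beta_nonneg _ _ _ _
  set Θ := Theta T L₁ L₂ M0₁ M0₂ with hΘ
  have hΘ0 : 0 ≤ Θ := Theta_nonneg hL₁ hL₂ hT
  obtain ⟨B, hlow⟩ := hc.exists_sub_le hL₂ h𝒟₂ hg hT
  set M1 := max 0 (max M1₁ M1₂) with hM1
  have hL₁' := hL₁.mono (M1' := M1) ((le_max_left _ _).trans (le_max_right _ _))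
  have hL₂' := hL₂.mono (M1' := M1) ((le_max_right _ _).trans (le_max_right _ _))
  set C := max M0₁ M0₂ + 2 * (T + 1) * M1 ^ 2 with hC
  have hC0 : 0 ≤ C := by
    have := (hL₁.M0_nonneg hT).trans (le_max_left M0₁ M0₂)
    positivity
  have hC₁ : M0₁ + 2 * (T + 1) * M1 ^ 2 ≤ C := by linarith [le_max_left M0₁ M0₂]
  have hC₂ : M0₂ + 2 * (T + 1) * M1 ^ 2 ≤ C := by linarith [le_max_right M0₁ M0₂]
  obtain ⟨l, h₀, hh₀, hstep⟩ := exists_smallStep hL₁' hL₂' (M1 := M1)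
    (K := max (K₁ : ℝ) K₂) (le_max_left _ _) hC0 he
  obtain ⟨n, hn⟩ := exists_nat_gt ((T - t₀) / h₀)
  have hTt : 0 < T - t₀ := sub_pos.2 h
  have hn0 : (0 : ℝ) < n := (div_pos hTt hh₀).trans hn
  set δ := (T - t₀) / n with hδ
  have hδ0 : 0 < δ := div_pos hTt hn0
  have hδh : δ ≤ h₀ := by
    rw [hδ, div_le_iff₀ hn0]
    rw [div_lt_iff₀ hh₀] at hn
    linarith
  have hnδ : t₀ + n * δ = T := by
    rw [hδ, mul_div_cancel₀ _ hn0.ne']; ring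
  set τ : ℕ → Icc t₀ T := node h.le δ with hτ
  have hτv : ∀ k ≤ n, (τ k : ℝ) = t₀ + k * δ := fun k hk => node_val h.le hδ0.le hnδ hk
  set q : ℕ → ℝ := fun k => p * Real.exp (b * (T - τ k)) with hq
  have hq0 : ∀ k, 0 < q k := fun k => by positivity
  have hqle : ∀ k, q k ≤ p * Real.exp (b * T) := by
    intro k
    refine mul_le_mul_of_nonneg_left (Real.exp_le_exp.2 (mul_le_mul_of_nonneg_left ?_ hb0)) hp.le
    linarith [ht₀.trans (τ k).2.1]
  have hκ : ∀ k, ∃ κ : St d → U, Measurable κ ∧ (k < n →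
      ∀ (𝔲 : Strategy d U t₀ T) (𝔳 : Strategy d V t₀ T) (m : Motion L₁ 𝒟₁ h.le x₀ 𝔲 𝔳),
      (∀ ω, ∀ r ∈ Ioo (τ k : ℝ) (τ (k + 1)),
        𝔲.control (m.X ω) (projIcc t₀ T h.le r) ω.2.1 = κ (m.X ω (τ k))) →
      ∫ ω, infConv (q (k + 1)) (c (τ (k + 1))) (m.X ω (τ (k + 1))) ∂m.P ≤
        ∫ ω, infConv (q k) (c (τ k)) (m.X ω (τ k)) ∂m.P
          + δ * (q (k + 1) * (Θ + 4 * e) + 2 * e)) := by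
    intro k
    by_cases hk : k < n
    · have e1 := hτv k hk.le
      have e2 := hτv (k + 1) hk
      have e3 : (τ (k + 1) : ℝ) - τ k = δ := by rw [e1, e2]; push_cast; ring
      have hlt : τ k < τ (k + 1) := by
        show (τ k : ℝ) < τ (k + 1)
        linarith
      obtain ⟨κ, hκm, hκ⟩ := exists_step_control hL₁' hL₂' (le_max_left _ _) (le_max_right _ _)
        hC₁ hC₂ h𝒟₁ h𝒟₂ hg hI hc hlow he ht₀ hlt
        (e3.symm ▸ hstep δ hδ0 hδh) (p := q k) (p' := q (k + 1)) (hq0 _) (by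
          simp only [hq]
          rw [mul_assoc, ← Real.exp_add]
          congr 2
          ring)
      refine ⟨κ, hκm, fun _ 𝔲 𝔳 m hm => ?_⟩
      have := hκ h.le x₀ 𝔲 𝔳 m hm
      rwa [e3] at this
    · obtain ⟨u⟩ := ‹Nonempty U›
      exact ⟨fun _ => u, measurable_const, fun h => absurd h hk⟩
  choose κ hκm hκ using hκ
  refine ⟨stepStrategy h.le hδ0.le hκm, stepStrategy_isStepwise h.le hδ0.le hκm hnδ,
    stepStrategy_isDeterministic h.le hδ0.le hκm, fun 𝔳 m => ?_⟩
  set A := p * Real.exp (b * T) * (Θ + 4 * e) + 2 * e with hA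
  have hA0 : 0 ≤ A := by positivity
  have hchain : ∀ k ≤ n, ∫ ω, infConv (q k) (c (τ k)) (m.X ω (τ k)) ∂m.P ≤
      ∫ ω, infConv (q 0) (c (τ 0)) (m.X ω (τ 0)) ∂m.P + k * δ * A := by
    intro k
    induction k with
    | zero => intro _; simp
    | succ k ih =>
      intro hk
      have h1 := ih (Nat.le_of_succ_le hk)
      have h2 := hκ k hk _ 𝔳 m fun ω r hr => by
        have e1 := hτv k (Nat.le_of_succ_le hk)
        have e2 := hτv (k + 1) hk
        have hr' : r ∈ Icc t₀ T := ⟨(τ k).2.1.trans hr.1.le, hr.2.le.trans (τ (k + 1)).2.2⟩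
        have e3 : stepIndex δ (projIcc t₀ T h.le r) = k := by
          refine stepIndex_eq hδ0 ?_ ?_
          · rw [projIcc_of_mem h.le hr', ← e1]; exact hr.1.le
          · rw [projIcc_of_mem h.le hr']
            have := hr.2
            rw [e2] at this
            push_cast at this
            exact this
        simp only [stepStrategy]
        rw [e3]
      have h3 : δ * (q (k + 1) * (Θ + 4 * e) + 2 * e) ≤ δ * A := by
        refine mul_le_mul_of_nonneg_left ?_ hδ0.le
        have := mul_le_mul_of_nonneg_right (hqle (k + 1)) (show 0 ≤ Θ + 4 * e by positivity)
        linarith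
      push_cast
      linarith
  have D := m.quadDyn hL₁ h𝒟₁ ht₀
  have hfin := hchain n le_rfl
  have hτ0 : τ 0 = ⟨t₀, left_mem_Icc.2 h.le⟩ := Subtype.ext (by rw [hτv 0 (Nat.zero_le n)]; simp)
  have hτn : τ n = ⟨T, right_mem_Icc.2 h.le⟩ := Subtype.ext (by rw [hτv n le_rfl, hnδ])
  have hqn : q n = p := by simp [hq, hτn]
  have hinit : ∫ ω, infConv (q 0) (c (τ 0)) (m.X ω (τ 0)) ∂m.P ≤ c t₀ x₀ := by
    have h1 : ∀ᵐ ω ∂m.P, infConv (q 0) (c (τ 0)) (m.X ω (τ 0)) = infConv (q 0) (c t₀) x₀ := by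
      filter_upwards [m.initial] with ω hω
      rw [hτ0, hω]
    rw [integral_congr_ae h1, integral_const, probReal_univ, one_smul]
    have := infConv_le hg (hlow t₀ ⟨ht₀, h.le⟩) (hq0 0) x₀ x₀
    simpa using this
  have hterm : m.payoff g ≤ ∫ ω, infConv (q n) (c (τ n)) (m.X ω (τ n)) ∂m.P + R ^ 2 / (4 * p) := by
    have hcg : ∀ y, g y - 0 ≤ c T y := fun y => by rw [hc.1 y, sub_zero]
    have hX := (D.exists_integral_norm_le.choose_spec ⟨T, right_mem_Icc.2 h.le⟩).1
    have hgX : Integrable (fun ω => g (m.X ω ⟨T, right_mem_Icc.2 h.le⟩)) m.P := by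
      refine ((integrable_const |g 0|).add (hX.norm.const_mul R)).mono'
        ((hg.continuous.measurable.comp (m.measurable_eval _)).aestronglyMeasurable)
        (Eventually.of_forall fun ω => ?_)
      have h1 := hg.dist_le_mul (m.X ω ⟨T, right_mem_Icc.2 h.le⟩) 0
      rw [Real.dist_eq, dist_zero_right] at h1
      have h2 := abs_sub_abs_le_abs_sub (g (m.X ω ⟨T, right_mem_Icc.2 h.le⟩)) (g 0)
      rw [Real.norm_eq_abs, Pi.add_apply]
      linarith
    have hi := D.integrable_infConv hg hcg hp ⟨T, right_mem_Icc.2 h.le⟩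
    have h1 := integral_mono hgX (hi.add (integrable_const (R ^ 2 / (4 * p)))) fun ω => by
      have := le_infConv hg hcg hp (m.X ω ⟨T, right_mem_Icc.2 h.le⟩)
      rw [Pi.add_apply]
      linarith
    simp only [Pi.add_apply] at h1
    rw [integral_add hi (integrable_const _)] at h1
    simp only [integral_const, probReal_univ, smul_eq_mul, one_mul] at h1
    rw [hτn, hqn]
    exact h1
  have hnA : n * δ * A ≤ T * A := mul_le_mul_of_nonneg_right (by linarith) hA0
  linarith

/-- The first player has a strategy as good as required. The penalty `p` balances the terminal
error `R² / (4 p)` against the growth `p C² Θ`; it is kept positive when `R` or `C² Θ`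
vanishes. -/
theorem exists_strategy_payoff_le_add (hL₁ : L₁.IsRegular T M0₁ M1₁ K₁)
    (hL₂ : L₂.IsRegular T M0₂ M1₂ K₂) (h𝒟₁ : IsTestClass 𝒟₁) (h𝒟₂ : IsTestClass 𝒟₂)
    (hg : LipschitzWith R g) (hI : L₁.Isaacs T ∨ L₂.Isaacs T) (hc : IsUStable T L₂ 𝒟₂ g c)
    {t₀ : ℝ} (ht₀ : 0 ≤ t₀) (h : t₀ ≤ T) (x₀ : St d) {ε : ℝ} (hε : 0 < ε) :
    ∃ 𝔲 : Strategy d U t₀ T, 𝔲.IsStepwise ∧ 𝔲.IsDeterministic ∧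
      ∀ (𝔳 : Strategy d V t₀ T) (m : Motion L₁ 𝒟₁ h x₀ 𝔲 𝔳),
        m.payoff g ≤ c t₀ x₀
          + R * constC T L₁ K₁ K₂ * √(Theta T L₁ L₂ M0₁ M0₂) + ε := by
  have hT : 0 ≤ T := ht₀.trans h
  set Θ := Theta T L₁ L₂ M0₁ M0₂ with hΘ
  have hΘ0 : 0 ≤ Θ := Theta_nonneg hL₁ hL₂ hT
  have hR0 : (0 : ℝ) ≤ R := R.2
  rcases h.eq_or_lt with rfl | hlt
  · obtain ⟨u⟩ := ‹Nonempty U›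
    have hκ : ∀ k : ℕ, Measurable ((fun _ _ => u : ℕ → St d → U) k) := fun _ => measurable_const
    refine ⟨stepStrategy h le_rfl hκ, stepStrategy_isStepwise h le_rfl hκ (n := 0) (by simp),
      stepStrategy_isDeterministic h le_rfl hκ, fun 𝔳 m => ?_⟩
    have h1 : m.payoff g = c t₀ x₀ := by
      have h2 : ∀ᵐ ω ∂m.P, g (m.X ω ⟨t₀, right_mem_Icc.2 h⟩) = c t₀ x₀ := by
        filter_upwards [m.initial] with ω hω
        rw [hω, hc.1]
      rw [Motion.payoff, integral_congr_ae h2]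
      simp
    have h3 : 0 ≤ R * constC t₀ L₁ K₁ K₂ * √Θ := by
      have := Real.sqrt_nonneg (t₀ * Real.exp (beta t₀ L₁ K₁ K₂ * t₀))
      rw [constC]
      positivity
    linarith
  set W := T * Real.exp (beta T L₁ K₁ K₂ * T) with hW
  have hW0 : 0 ≤ W := by positivity
  set S := √W * √Θ with hS
  have hS0 : 0 ≤ S := by positivity
  have hSS : W * Θ = S ^ 2 := by rw [hS, mul_pow, Real.sq_sqrt hW0, Real.sq_sqrt hΘ0]
  set η := ε / (S + R + 1) with hη
  have hη0 : 0 < η := by positivity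
  have hηε : η * (S + R) ≤ ε := by
    rw [hη, div_mul_eq_mul_div, div_le_iff₀ (by positivity)]
    exact mul_le_mul_of_nonneg_left (by linarith) hε.le
  set p := (R + η) / (2 * (S + η)) with hp
  have hp0 : 0 < p := by positivity
  have hb1 : p * S ^ 2 ≤ (R + η) * S / 2 := by
    rw [hp, div_mul_eq_mul_div, div_le_iff₀ (by positivity)]
    have : 0 ≤ (R + η) * S * η := by positivity
    nlinarith
  have hb2 : R ^ 2 / (4 * p) ≤ R * (S + η) / 2 := by
    have e1 : R ^ 2 / (4 * p) = R ^ 2 * (S + η) / (2 * (R + η)) := by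
      rw [hp]; field_simp; ring
    rw [e1, div_le_iff₀ (by positivity)]
    have : 0 ≤ R * (S + η) * η := by positivity
    nlinarith
  set Z := T * (4 * (p * Real.exp (beta T L₁ K₁ K₂ * T)) + 2) with hZ
  have hZ0 : 0 ≤ Z := by positivity
  set e := ε / (2 * (Z + 1)) with he
  have he0 : 0 < e := by positivity
  have hZe : Z * e ≤ ε / 2 := by
    rw [he, mul_div_assoc', div_le_div_iff₀ (by positivity) (by positivity)]
    nlinarith
  obtain ⟨𝔲, h1, h2, h3⟩ := exists_strategy_payoff_le hL₁ hL₂ h𝒟₁ h𝒟₂ hg hI hc he0 ht₀ hlt x₀ hp0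
  refine ⟨𝔲, h1, h2, fun 𝔳 m => (h3 𝔳 m).trans ?_⟩
  have e1 : T * (p * Real.exp (beta T L₁ K₁ K₂ * T) * (Θ + 4 * e) + 2 * e)
      = p * S ^ 2 + Z * e := by
    rw [← hSS, hW, hZ]; ring
  have e2 : R * constC T L₁ K₁ K₂ * √Θ = R * S := by
    rw [constC, hS]; ring
  rw [e1, e2]
  linarith

end Game

end StochGame

theorem mainTheorem2 {d : ℕ} {U V : Type*}
    [MetricSpace U] [CompactSpace U] [Nonempty U] [MeasurableSpace U] [BorelSpace U]
    [MetricSpace V] [CompactSpace V] [Nonempty V] [MeasurableSpace V] [BorelSpace V]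
    (T : ℝ) (L₁ L₂ : StochGame.Coefficients d U V)
    (M0₁ M0₂ M1₁ M1₂ : ℝ) (K₁ K₂ R : ℝ≥0)
    (hL₁ : L₁.IsRegular T M0₁ M1₁ K₁) (hL₂ : L₂.IsRegular T M0₂ M1₂ K₂)
    (𝒟₁ 𝒟₂ : Set (StochGame.St d → ℝ))
    (h𝒟₁ : StochGame.IsTestClass 𝒟₁) (h𝒟₂ : StochGame.IsTestClass 𝒟₂)
    (g : StochGame.St d → ℝ) (hg : LipschitzWith R g)
    (hIsaacs : L₁.Isaacs T ∨ L₂.Isaacs T)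
    (c : ℝ → StochGame.St d → ℝ) (hc : StochGame.IsUStable T L₂ 𝒟₂ g c)
    (t₀ : ℝ) (ht₀ : 0 ≤ t₀) (ht₀T : t₀ ≤ T) (x₀ : StochGame.St d) :
    StochGame.upperValue L₁ 𝒟₁ g ht₀T x₀ ≤
        ((c t₀ x₀ + R * StochGame.constC T L₁ K₁ K₂ * √(StochGame.Theta T L₁ L₂ M0₁ M0₂) : ℝ) :
          EReal) ∧
      ∀ ε : ℝ, 0 < ε → ∃ 𝔲 : StochGame.Strategy d U t₀ T, 𝔲.IsStepwise ∧ 𝔲.IsDeterministic ∧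
        ∀ (𝔳 : StochGame.Strategy d V t₀ T) (m : StochGame.Motion L₁ 𝒟₁ ht₀T x₀ 𝔲 𝔳),
          m.payoff g ≤ c t₀ x₀ +
            R * StochGame.constC T L₁ K₁ K₂ * √(StochGame.Theta T L₁ L₂ M0₁ M0₂) + ε := by
  have key := fun (ε : ℝ) (hε : 0 < ε) => StochGame.exists_strategy_payoff_le_add hL₁ hL₂ h𝒟₁ h𝒟₂
    hg hIsaacs hc ht₀ ht₀T x₀ hε
  refine ⟨EReal.le_of_forall_lt_iff_le.1 fun r hr => ?_, key⟩
  rw [EReal.coe_lt_coe_iff] at hr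
  obtain ⟨𝔲, -, -, h𝔲⟩ := key _ (sub_pos.2 hr)
  refine (iInf_le _ 𝔲).trans (iSup_le fun 𝔳 => iSup_le fun m => ?_)
  rw [EReal.coe_le_coe_iff]
  linarith [h𝔲 𝔳 m]
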